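/- Let $\Omega\subseteq\mathbb{C}$ be a simply connected domain, and let $\mathcal{H}_{l.u.}(\Omega)$ be the set of all locally univalent holomorphic functions on $\Omega$, that is, of all holomorphic $f:\Omega\to\mathbb{C}$ with $f'(z)\neq 0$ for every $z\in\Omega$, equipped with the topology of locally uniform convergence on $\Omega$. Let $\Phi$ be a family of locally univalent self-maps of $\Omega$ (holomorphic maps $\phi:\Omega\to\Omega$ with $\phi'(z)\ne 0$ for every $z\in\Omega$) which contains a sequence $(\phi_n)_{n\in\mathbb{N}}$ that is (i) run-away: for every compact set $K\subseteq\Omega$ there is an $n\in\mathbb{N}$ with $\phi_n(K)\cap K=\emptyset$; and (ii) eventually injective: for every compact set $K\subseteq\Omega$ there is an $N\in\mathbb{N}$ such that $\phi_n|_K$ is injective for all $n\ge N$. Call $G\in\mathcal{H}_{l.u.}(\Omega)$ $\Phi$-universal in $\mathcal{H}_{l.u.}(\Omega)$ if $\{G\circ\phi : \phi\in\Phi\}$ is dense in $\mathcal{H}_{l.u.}(\Omega)$. Then there is a $\Phi$-universal function in $\mathcal{H}_{l.u.}(\Omega)$, and the set of all $\Phi$-universal functions in $\mathcal{H}_{l.u.}(\Omega)$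 is a dense $G_\delta$-subset of $\mathcal{H}_{l.u.}(\Omega)$. -/

import Mathlib

open TopologicalSpace

namespace LocUniv

/-- `f : Ω → ℂ` is holomorphic on the open set `Ω ⊆ ℂ` with `f'(z) ≠ 0` for every `z ∈ Ω`.
Holomorphy and the derivative are those of an arbitrary extension `F` of `f` to the plane; as `Ω`
is open, they depend only on the values of `F` on `Ω`, that is, on `f`. -/
def IsLocallyUnivalent {Ω : Opens ℂ} (f : Ω → ℂ) : Prop :=
  ∃ F : ℂ → ℂ, (∀ z : Ω, F z = f z) ∧ DifferentiableOn ℂ F Ω ∧ ∀ z ∈ Ω, deriv F z ≠ 0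

/-- The self-map `φ` of `Ω` is locally univalent. -/
def IsLocallyUnivalentSelfMap {Ω : Opens ℂ} (φ : C(Ω, Ω)) : Prop :=
  IsLocallyUnivalent (fun z : Ω => (φ z : ℂ))

/-- The locally univalent holomorphic functions on `Ω`, as a subset of `C(Ω, ℂ)`, whose topology
in Mathlib is the compact-open one, that is, the topology of locally uniform convergence. -/
def Hlu (Ω : Opens ℂ) : Set C(Ω, ℂ) :=
  {f | IsLocallyUnivalent (f : Ω → ℂ)}

/-- A sequence of self-maps of `Ω` is run-away. -/
def IsRunAway {Ω : Opens ℂ} (φ : ℕ → C(Ω, Ω)) : Prop :=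
  ∀ K : Set Ω, IsCompact K → ∃ n, φ n '' K ∩ K = ∅

/-- A sequence of self-maps of `Ω` is eventually injective. -/
def IsEventuallyInjective {Ω : Opens ℂ} (φ : ℕ → C(Ω, Ω)) : Prop :=
  ∀ K : Set Ω, IsCompact K → ∃ N, ∀ n ≥ N, Set.InjOn (φ n) K

/-- The orbit `{G ∘ φ : φ ∈ Φ}`. -/
def orbit {Ω : Opens ℂ} (Φ : Set C(Ω, Ω)) (G : C(Ω, ℂ)) : Set C(Ω, ℂ) :=
  {g | ∃ φ ∈ Φ, g = G.comp φ}

/-- `G` is `Φ`-universal in `𝒢`: it belongs to `𝒢`, and its orbit is a dense subset of `𝒢`. -/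
def IsUniversalIn {Ω : Opens ℂ} (Φ : Set C(Ω, Ω)) (𝒢 : Set C(Ω, ℂ)) (G : C(Ω, ℂ)) : Prop :=
  G ∈ 𝒢 ∧ orbit Φ G ⊆ 𝒢 ∧ 𝒢 ⊆ closure (orbit Φ G)

end LocUniv

/-! `Hlu Ω` is a `Gδ` subset of the completely metrizable space `C(Ω, ℂ)`, hence a Baire space, and
universality is a countable conjunction of open conditions, one for each basic open set meeting `Hlu
Ω`. By Baire's theorem everything reduces to topological transitivity (`exists_transitive`): given
`G₀`, `g` and a compact set, find a locally univalent `G` close to `G₀` there with `G ∘ φ n` close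
to `g`.

Enlarge the compact set to `T` with connected complement and pick `n` with `φ n` injective near `T`
and `L = φ n (T)` disjoint from `T`. Then `L` has connected complement too. Seek `G` entire with `G'
= exp p`, `p` a polynomial, so that `G'` never vanishes: `p` has to approximate a logarithm of `G₀'`
on `T` and one of the derivative of `g ∘ (φ n)⁻¹` on `L`. Values on `T` are fixed by the constant of
integration, but those on `L` then depend on the integral of `exp p` along a path from `T` to `L`.
So `p` is also prescribed on a segment joining nearest points of `T` and `L`, with the right
integral (`exists_entire_bridge`).

This needs approximation on a set that includes the segment, where the target is merely smooth. As
the segment is a null set, `exists_polynomial_approx_of_dbar`, which asks for the Cauchy–Riemann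
equations only almost everywhere, suffices; it comes from the Cauchy–Pompeiu formula and pole
pushing. Connectedness of complements is handled throughout by one criterion: it holds for compact
`K` exactly when `w - a` has a continuous logarithm on `K` for every `a ∉ K`. -/

namespace LocUniv

open Set Filter Topology Complex

/-! ### Continuous logarithms and separation of the plane -/

/-- `f` has a continuous logarithm on `K`. -/
def HasContLog (f : ℂ → ℂ) (K : Set ℂ) : Prop :=
  ∃ h : ℂ → ℂ, ContinuousOn h K ∧ ∀ z ∈ K, exp (h z) = f z

theorem HasContLog.mul {f g : ℂ → ℂ} {K : Set ℂ} (hf : HasContLog f K) (hg : HasContLog g K) :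
    HasContLog (fun z => f z * g z) K := by
  obtain ⟨h, hc, he⟩ := hf
  obtain ⟨h', hc', he'⟩ := hg
  exact ⟨fun z => h z + h' z, hc.add hc', fun z hz => by rw [exp_add, he z hz, he' z hz]⟩

theorem HasContLog.congr {f g : ℂ → ℂ} {K : Set ℂ} (hf : HasContLog f K)
    (hfg : ∀ z ∈ K, f z = g z) : HasContLog g K := by
  obtain ⟨h, hc, he⟩ := hf
  exact ⟨h, hc, fun z hz => (he z hz).trans (hfg z hz)⟩

theorem hasContLog_const {c : ℂ} (hc : c ≠ 0) (K : Set ℂ) : HasContLog (fun _ => c) K :=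
  ⟨fun _ => log c, continuousOn_const, fun _ _ => exp_log hc⟩

/-- A continuous function within distance less than one of `1` has a continuous logarithm. -/
theorem hasContLog_one_add {u : ℂ → ℂ} {K : Set ℂ} (hu : ContinuousOn u K)
    (h1 : ∀ z ∈ K, ‖u z‖ < 1) : HasContLog (fun z => 1 + u z) K := by
  have hs : ∀ z ∈ K, 1 + u z ∈ slitPlane := fun z hz => mem_slitPlane_of_norm_lt_one (h1 z hz)
  refine ⟨fun z => log (1 + u z), (continuousOn_const.add hu).clog hs, fun z hz => ?_⟩
  exact exp_log (slitPlane_ne_zero (hs z hz))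

/-- The identity has no continuous logarithm on a circle. -/
theorem no_continuous_log_circle {H : ℂ → ℂ} (hH : Continuous H) (a : ℂ) {R : ℝ}
    (h : ∀ w, ‖w - a‖ = R → exp (H w) = w - a) (hR : 0 < R) : False := by
  set u : ℝ → ℂ := fun t => H (a + R * exp (t * I)) - t * I with hu
  have hw : ∀ t : ℝ, exp (u t) = R := by
    intro t
    rw [hu]
    simp only [exp_sub]
    rw [h]
    · field_simp [exp_ne_zero]
      ring
    · simp [norm_exp_ofReal_mul_I, abs_of_pos hR]
  have hc : Continuous u := by fun_prop
  -- `u` lifts a constant path through the covering `exp`, so it is constant; but a full turn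
  -- changes it by `-2πi`.
  have key : u = fun _ => u 0 := by
    refine isCoveringMap_exp.eq_of_comp_eq hc continuous_const ?_ 0 rfl
    funext t
    simp [hw]
  have h2 := congrFun key (2 * Real.pi)
  simp only [hu] at h2
  have e : exp (((2 * Real.pi : ℝ) : ℂ) * I) = 1 := by push_cast; exact exp_two_pi_mul_I
  rw [e] at h2
  simp [Real.pi_ne_zero] at h2

/-- Components of an open set are open: a frontier point off `K` has an open component that meets
the given one, hence equals it. -/
theorem frontier_connectedComponentIn_compl_subset {K : Set ℂ} (hK : IsClosed K) (a : ℂ) :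
    frontier (connectedComponentIn Kᶜ a) ⊆ K := by
  intro x hx
  by_contra hxK
  have ho : IsOpen (connectedComponentIn Kᶜ a) := hK.isOpen_compl.connectedComponentIn
  have hox : IsOpen (connectedComponentIn Kᶜ x) := hK.isOpen_compl.connectedComponentIn
  obtain ⟨y, hy1, hy2⟩ := mem_closure_iff.1 hx.1 _ hox (mem_connectedComponentIn hxK)
  have e := (connectedComponentIn_eq hy1).trans (connectedComponentIn_eq hy2).symm
  apply hx.2
  rw [ho.interior_eq, ← e]
  exact mem_connectedComponentIn hxK

theorem isSimplyConnected_univ_complex : IsSimplyConnected (univ : Set ℂ) := by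
  have : ContractibleSpace (univ : Set ℂ) := convex_univ.contractibleSpace univ_nonempty
  exact (inferInstance : SimplyConnectedSpace (univ : Set ℂ))

/-- If `w - a` has a continuous logarithm on the compact set `K`, then `K` does not separate `a`
from infinity. -/
theorem not_isBounded_component_of_log {K : Set ℂ} (hK : IsCompact K) {a : ℂ} (ha : a ∉ K)
    (hl : HasContLog (fun w => w - a) K) :
    ¬ Bornology.IsBounded (connectedComponentIn Kᶜ a) := by
  intro hb
  obtain ⟨h, hc, he⟩ := hl
  obtain ⟨h', hh'⟩ := ContinuousMap.exists_restrict_eq hK.isClosed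
    (⟨K.domRestrict h, continuousOn_iff_continuous_domRestrict.1 hc⟩ : C(K, ℂ))
  have hext : ∀ z ∈ K, h' z = h z := fun z hz => by
    exact DFunLike.congr_fun hh' ⟨z, hz⟩
  set V := connectedComponentIn Kᶜ a with hV
  classical
  -- If `V` were bounded, gluing the exponential of a Tietze extension of the logarithm on `V` to `w
  -- - a` off `V` would give a zero-free continuous function on the plane. Its global logarithm
  -- would be a logarithm of `w - a` on a large circle.
  set F : ℂ → ℂ := V.piecewise (fun w => exp (h' w)) (fun w => w - a) with hF
  have hFc : Continuous F := by
    refine Continuous.piecewise (fun w hw => ?_) (by fun_prop) (by fun_prop)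
    have hwK := frontier_connectedComponentIn_compl_subset hK.isClosed a hw
    rw [hext w hwK, he w hwK]
  have hF0 : ∀ w, F w ≠ 0 := by
    intro w
    by_cases hw : w ∈ V
    · simp [hF, hw, exp_ne_zero]
    · simp only [hF, piecewise_eq_of_notMem _ _ _ hw]
      intro h0
      apply hw
      rw [sub_eq_zero.1 h0]
      exact mem_connectedComponentIn ha
  obtain ⟨H, hHc, hH⟩ := exists_continuousOn_eqOn_exp_comp (X := ℂ) (U := univ) (g := F)
    isSimplyConnected_univ_complex isOpen_univ hFc.continuousOn
    (by rintro ⟨w, -, hw⟩; exact hF0 w hw)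
  obtain ⟨R, hR, hVR⟩ := hb.subset_ball_lt 0 a
  refine no_continuous_log_circle (continuousOn_univ.1 hHc) a (R := R) (fun w hw => ?_) hR
  have hwV : w ∉ V := fun hwV => by
    have := hVR hwV
    rw [Metric.mem_ball, dist_eq] at this
    linarith
  have := hH (mem_univ w)
  simpa [hF, hwV] using this

theorem isPreconnected_compl_closedBall_zero {R : ℝ} (hR : 0 < R) :
    IsPreconnected (Metric.closedBall (0 : ℂ) R)ᶜ := by
  have : (Metric.closedBall (0 : ℂ) R)ᶜ = exp '' {z | Real.log R < z.re} := by
    ext w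
    simp only [mem_compl_iff, Metric.mem_closedBall, dist_zero_right, not_le, mem_image,
      mem_ofPred_eq]
    constructor
    · intro hw
      have hw0 : w ≠ 0 := by rintro rfl; simp at hw; linarith
      exact ⟨log w, by rw [log_re]; exact Real.log_lt_log hR hw, exp_log hw0⟩
    · rintro ⟨z, hz, rfl⟩
      rw [norm_exp]
      exact (Real.log_lt_iff_lt_exp hR).1 hz
  rw [this]
  exact ((convex_halfSpace_re_gt _).isPreconnected).image _ continuous_exp.continuousOn

theorem exists_subset_closedBall_zero {K : Set ℂ} (hK : IsCompact K) :
    ∃ R : ℝ, 0 < R ∧ K ⊆ Metric.closedBall 0 R := by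
  obtain ⟨R, h1, h2⟩ := hK.isBounded.subset_closedBall_lt 0 0
  exact ⟨R, h1, h2⟩

/-- Every unbounded component meets the exterior of a large disc, which is connected. -/
theorem isPreconnected_compl_of_unbounded {K : Set ℂ} (hK : IsCompact K)
    (h : ∀ a ∉ K, ¬ Bornology.IsBounded (connectedComponentIn Kᶜ a)) : IsPreconnected Kᶜ := by
  obtain ⟨R, hR, hKR⟩ := exists_subset_closedBall_zero hK
  have hO := isPreconnected_compl_closedBall_zero hR
  set O := (Metric.closedBall (0 : ℂ) R)ᶜ with hOdef
  have hOK : O ⊆ Kᶜ := compl_subset_compl.2 hKR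
  have hx0 : ((R + 1 : ℝ) : ℂ) ∈ O := by
    simp [hOdef, -ofReal_add, abs_of_pos (by linarith : 0 < R + 1)]
  refine isPreconnected_of_forall ((R + 1 : ℝ) : ℂ) fun y hy => ?_
  have : ∃ z ∈ connectedComponentIn Kᶜ y, z ∈ O := by
    by_contra! hne
    refine h y hy ((Metric.isBounded_closedBall (x := 0) (r := R)).subset fun z hz => ?_)
    by_contra hz'
    exact hne z hz hz'
  obtain ⟨z, hz1, hz2⟩ := this
  exact ⟨connectedComponentIn Kᶜ y ∪ O, union_subset (connectedComponentIn_subset _ _) hOK,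
    Or.inr hx0, Or.inl (mem_connectedComponentIn hy),
    isPreconnected_connectedComponentIn.union z hz1 hz2 hO⟩

theorem isPreconnected_compl_of_log {K : Set ℂ} (hK : IsCompact K)
    (h : ∀ a ∉ K, HasContLog (fun w => w - a) K) : IsPreconnected Kᶜ :=
  isPreconnected_compl_of_unbounded hK fun a ha => not_isBounded_component_of_log hK ha (h a ha)

/-- `w - a = (w - b) (1 + (b - a) / (w - b))`, and the second factor is within distance less than
one of `1`. -/
theorem hasContLog_sub_of_near {K : Set ℂ} {a b : ℂ} (h : ∀ z ∈ K, ‖b - a‖ < ‖z - b‖)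
    (hb : HasContLog (fun w => w - b) K) : HasContLog (fun w => w - a) K := by
  have h0 : ∀ z ∈ K, z - b ≠ 0 := fun z hz => norm_pos_iff.1 ((norm_nonneg _).trans_lt (h z hz))
  refine (hb.mul (hasContLog_one_add (u := fun z => (b - a) / (z - b)) ?_ ?_)).congr ?_
  · exact continuousOn_const.div (by fun_prop) h0
  · intro z hz
    rw [norm_div, div_lt_one (norm_pos_iff.2 (h0 z hz))]
    exact h z hz
  · intro z hz
    have := h0 z hz
    field_simp
    ring

/-- If the complement of the compact set `K` is connected, then `w - a` has a continuous
logarithm on `K` for every `a ∉ K`. -/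
theorem hasContLog_sub_of_isPreconnected_compl {K : Set ℂ} (hK : IsCompact K)
    (hc : IsPreconnected Kᶜ) {a : ℂ} (ha : a ∉ K) : HasContLog (fun w => w - a) K := by
  rcases K.eq_empty_or_nonempty with rfl | hne
  · exact ⟨fun _ => 0, by simp, by simp⟩
  -- `A` is open, relatively closed in `Kᶜ`, and contains a point far away; so it is all of `Kᶜ`.
  set A : Set ℂ := {a | a ∉ K ∧ HasContLog (fun w => w - a) K} with hA
  have near : ∀ a ∉ K, ∃ δ > 0, ∀ b, ‖b - a‖ < δ → (b ∉ K ∧ (∀ z ∈ K, ‖b - a‖ < ‖z - b‖) ∧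
      ∀ z ∈ K, ‖a - b‖ < ‖z - a‖) := by
    intro a ha
    have hd := (hK.isClosed.notMem_iff_infDist_pos hne).1 ha
    refine ⟨Metric.infDist a K / 2, by linarith, fun b hb => ?_⟩
    have h1 : ∀ z ∈ K, Metric.infDist a K ≤ ‖z - a‖ := fun z hz => by
      rw [← dist_eq, dist_comm]; exact Metric.infDist_le_dist_of_mem hz
    have h2 : ∀ z, ‖z - a‖ ≤ ‖z - b‖ + ‖b - a‖ := fun z => by
      simpa using norm_add_le (z - b) (b - a)
    refine ⟨fun hbK => ?_, fun z hz => ?_, fun z hz => ?_⟩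
    · have := h1 b hbK; linarith
    · have := h1 z hz; have := h2 z; linarith
    · have := h1 z hz; rw [norm_sub_rev]; linarith
  have hAo : IsOpen A := by
    rw [Metric.isOpen_iff]
    rintro a ⟨ha, hl⟩
    obtain ⟨δ, hδ, h⟩ := near a ha
    refine ⟨δ, hδ, fun b hb => ?_⟩
    rw [Metric.mem_ball, dist_eq] at hb
    obtain ⟨h1, h2, h3⟩ := h b hb
    exact ⟨h1, hasContLog_sub_of_near h3 hl⟩
  have hAne : (Kᶜ ∩ A).Nonempty := by
    obtain ⟨R, hR, hKR⟩ := exists_subset_closedBall_zero hK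
    have hn : ∀ z ∈ K, ‖z‖ < ‖((R + 1 : ℝ) : ℂ)‖ := by
      intro z hz
      have := hKR hz
      rw [norm_real, Real.norm_of_nonneg (by linarith)]
      simp at this
      linarith
    have hne0 : ((R + 1 : ℝ) : ℂ) ≠ 0 := by exact_mod_cast (by linarith : R + 1 ≠ 0)
    have hm : ((R + 1 : ℝ) : ℂ) ∉ K := fun h => lt_irrefl _ (hn _ h)
    refine ⟨_, hm, hm, ?_⟩
    refine ((hasContLog_const (neg_ne_zero.2 hne0) K).mul (hasContLog_one_add
      (u := fun z => -z / ((R + 1 : ℝ) : ℂ)) (by fun_prop) fun z hz => ?_)).congr fun z hz => ?_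
    · rw [norm_div, norm_neg, div_lt_one (norm_pos_iff.2 hne0)]
      exact hn z hz
    · field_simp
      ring
  refine (hc.subset_of_closure_inter_subset hAo hAne ?_ ha).2
  rintro x ⟨hx, hxK⟩
  obtain ⟨δ, hδ, h⟩ := near x hxK
  obtain ⟨b, hb, hbx⟩ := Metric.mem_closure_iff.1 hx δ hδ
  rw [dist_comm, dist_eq] at hbx
  exact ⟨hxK, hasContLog_sub_of_near (h b hbx).2.1 hb.2⟩

/-! ### Filling the holes of a compact set; holomorphic logarithms -/

/-- `K` together with the bounded components of its complement. -/
def fill (K : Set ℂ) : Set ℂ :=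
  {z | z ∈ K ∨ Bornology.IsBounded (connectedComponentIn Kᶜ z)}

theorem subset_fill (K : Set ℂ) : K ⊆ fill K := fun _ hz => Or.inl hz

theorem component_subset_compl_fill {K : Set ℂ} {z : ℂ} (hz : z ∉ fill K) :
    connectedComponentIn Kᶜ z ⊆ (fill K)ᶜ := by
  intro w hw hwf
  rcases hwf with h | h
  · exact connectedComponentIn_subset _ _ hw h
  · rw [← connectedComponentIn_eq hw] at h
    exact hz (Or.inr h)

theorem component_subset_fill {K : Set ℂ} {z : ℂ} (hz : z ∈ fill K) (hzK : z ∉ K) :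
    connectedComponentIn Kᶜ z ⊆ fill K := by
  intro w hw
  refine Or.inr ?_
  rw [← connectedComponentIn_eq hw]
  exact hz.resolve_left hzK

theorem isCompact_fill {K : Set ℂ} (hK : IsCompact K) : IsCompact (fill K) := by
  obtain ⟨R, hR, hKR⟩ := exists_subset_closedBall_zero hK
  refine Metric.isCompact_of_isClosed_isBounded ?_ ?_
  · rw [← isOpen_compl_iff, isOpen_iff_mem_nhds]
    intro z hz
    have hzK : z ∈ Kᶜ := fun h => hz (Or.inl h)
    exact mem_of_superset
      (hK.isClosed.isOpen_compl.connectedComponentIn.mem_nhds (mem_connectedComponentIn hzK))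
      (component_subset_compl_fill hz)
  · refine (Metric.isBounded_closedBall (x := 0) (r := R)).subset fun z hz => ?_
    by_contra hzR
    rcases hz with h | h
    · exact hzR (hKR h)
    -- The component of a point outside the disc contains the whole exterior; were it bounded, so
    -- would be the plane.
    · have hs := (isPreconnected_compl_closedBall_zero hR).subset_connectedComponentIn
        (x := z) hzR (compl_subset_compl.2 hKR)
      have := (h.subset hs).union (Metric.isBounded_closedBall (x := (0 : ℂ)) (r := R))
      rw [compl_union_self] at this
      exact NormedSpace.unbounded_univ ℂ ℂ this

theorem isPreconnected_compl_fill {K : Set ℂ} (hK : IsCompact K) : IsPreconnected (fill K)ᶜ := by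
  refine isPreconnected_compl_of_unbounded (isCompact_fill hK) fun a ha hb => ?_
  apply ha
  have haK : a ∈ Kᶜ := fun h => ha (Or.inl h)
  exact Or.inr (hb.subset (isPreconnected_connectedComponentIn.subset_connectedComponentIn
    (mem_connectedComponentIn haK) (component_subset_compl_fill ha)))

/-- A point of `fill K` off `K` has its whole open component in `fill K`. This lets the maximum
principle carry bounds from `K` to `fill K`. -/
theorem frontier_fill_subset {K : Set ℂ} (hK : IsCompact K) : frontier (fill K) ⊆ K := by
  intro z hz
  by_contra hzK
  have hzf : z ∈ fill K := by
    have := hz.1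
    rwa [(isCompact_fill hK).isClosed.closure_eq] at this
  exact hz.2 (mem_interior_iff_mem_nhds.2 (mem_of_superset
    (hK.isClosed.isOpen_compl.connectedComponentIn.mem_nhds (mem_connectedComponentIn hzK))
    (component_subset_fill hzf hzK)))

/-- A nonvanishing holomorphic function on a simply connected open set is the exponential of a
holomorphic function. -/
theorem exists_differentiableOn_log {Ω : Opens ℂ} [SimplyConnectedSpace Ω] {f : ℂ → ℂ}
    (hf : DifferentiableOn ℂ f Ω) (h0 : ∀ z ∈ Ω, f z ≠ 0) :
    ∃ h : ℂ → ℂ, DifferentiableOn ℂ h Ω ∧ ∀ z ∈ Ω, exp (h z) = f z := by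
  obtain ⟨h, hc, he⟩ := exists_continuousOn_eqOn_exp_comp (X := ℂ) (U := (Ω : Set ℂ)) (g := f)
    (show SimplyConnectedSpace Ω from inferInstance) Ω.isOpen hf.continuousOn
    (by rintro ⟨w, hw, hw'⟩; exact h0 w hw hw')
  refine ⟨h, fun z hz => ?_, he⟩
  have hca : ContinuousAt h z := hc.continuousAt (Ω.isOpen.mem_nhds hz)
  have hfd : DifferentiableAt ℂ f z := hf.differentiableAt (Ω.isOpen.mem_nhds hz)
  have hfz := h0 z hz
  -- Near `z`, where `h w - h z` has norm below `π`, the continuous logarithm is `h z` plus the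
  -- principal logarithm of `f w / f z`.
  have h1 : DifferentiableAt ℂ (fun w => h z + log (f w / f z)) z := by
    refine (DifferentiableAt.clog (hfd.div_const _) ?_).const_add _
    rw [div_self hfz]
    exact one_mem_slitPlane
  refine (h1.congr_of_eventuallyEq ?_).differentiableWithinAt
  have h2 : ∀ᶠ w in 𝓝 z, ‖h w - h z‖ < Real.pi := by
    have : Tendsto (fun w => ‖h w - h z‖) (𝓝 z) (𝓝 0) := by
      have := (hca.sub_const (h z)).norm
      simpa [ContinuousAt] using this
    exact this.eventually (gt_mem_nhds Real.pi_pos)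
  filter_upwards [h2, Ω.isOpen.mem_nhds hz] with w hw hwΩ
  have e : f w / f z = exp (h w - h z) := by
    rw [exp_sub, show exp (h w) = f w from he hwΩ, show exp (h z) = f z from he hz]
  have him := (abs_le.1 (abs_im_le_norm (h w - h z)))
  rw [e, log_exp (by linarith) (by linarith)]
  ring

/-- For `a ∉ Ω` the function `z - a` has a logarithm on `Ω`, so `K` cannot separate `a` from
infinity. -/
theorem fill_subset {Ω : Opens ℂ} [SimplyConnectedSpace Ω] {K : Set ℂ} (hK : IsCompact K)
    (hKΩ : K ⊆ Ω) : fill K ⊆ Ω := by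
  intro a ha
  by_contra haΩ
  rcases ha with h | h
  · exact haΩ (hKΩ h)
  · obtain ⟨l, hl, he⟩ := exists_differentiableOn_log (Ω := Ω) (f := fun z => z - a) (by fun_prop)
      (fun z hz h => haΩ (by rwa [← sub_eq_zero.1 h]))
    exact not_isBounded_component_of_log hK (fun h => haΩ (hKΩ h))
      ⟨l, hl.continuousOn.mono hKΩ, fun z hz => he z (hKΩ hz)⟩ h

end LocUniv

/-! ### The Cauchy–Pompeiu formula -/

namespace LocUniv

open Set Filter Topology Complex MeasureTheory

/-- The Wirtinger derivative of `h` with respect to the conjugate variable. -/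
noncomputable def dbar (h : ℂ → ℂ) (w : ℂ) : ℂ :=
  (fderiv ℝ h w 1 + I * fderiv ℝ h w I) / 2

theorem dbar_eq_zero_of_differentiableAt {h : ℂ → ℂ} {w : ℂ} (hw : DifferentiableAt ℂ h w) :
    dbar h w = 0 := by
  have h1 : fderiv ℝ h w = (fderiv ℂ h w).restrictScalars ℝ :=
    (hw.hasFDerivAt.restrictScalars ℝ).fderiv
  have h2 : fderiv ℂ h w I = I * fderiv ℂ h w 1 := by simp
  rw [dbar, h1]
  simp only [ContinuousLinearMap.coe_restrictScalars']
  rw [h2, ← mul_assoc, I_mul_I]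
  ring

theorem continuous_dbar {h : ℂ → ℂ} (hh : ContDiff ℝ 1 h) : Continuous (dbar h) := by
  have := hh.continuous_fderiv one_ne_zero
  unfold dbar
  fun_prop

/-- Rotating the frame `1, I` by `θ` absorbs the phase of the kernel `1 / w`, leaving a radial and a
tangential derivative, each of which can be integrated exactly. -/
theorem dbar_polar (D : ℂ →L[ℝ] ℂ) (θ : ℝ) :
    (D 1 + I * D I) / 2 / exp (θ * I) = (D (exp (θ * I)) + I * D (I * exp (θ * I))) / 2 := by
  have e : exp (θ * I) = (Real.cos θ) • (1 : ℂ) + (Real.sin θ) • I := by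
    rw [exp_mul_I]; simp
  have e2 : I * exp (θ * I) = (-Real.sin θ) • (1 : ℂ) + (Real.cos θ) • I := by
    rw [e]
    simp only [real_smul, ofReal_neg]
    linear_combination (Real.sin θ : ℂ) * I_mul_I
  have hne := exp_ne_zero (θ * I)
  rw [e2, map_add, map_smul, map_smul, div_eq_iff hne, e, map_add, map_smul, map_smul]
  simp only [real_smul, ofReal_neg]
  have hsc : (Real.cos θ : ℂ) ^ 2 + (Real.sin θ : ℂ) ^ 2 = 1 := by
    exact_mod_cast Real.cos_sq_add_sin_sq θ
  linear_combination (-(D 1 + I * D I) / 2) * hsc +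
    ((Real.sin θ : ℂ) ^ 2 * D 1 / 2 - D I * Real.sin θ * Real.cos θ / 2) * I_mul_I

/-- **Cauchy–Pompeiu formula** for continuously differentiable functions of compact support. -/
theorem integral_dbar_div {h : ℂ → ℂ} (hh : ContDiff ℝ 1 h) (hs : HasCompactSupport h) (z : ℂ) :
    ∫ w, dbar h (z + w) / w = -(Real.pi * h z) := by
  obtain ⟨R, hR, hsR⟩ : ∃ R : ℝ, 0 < R ∧ ∀ w, R ≤ ‖w‖ → z + w ∉ tsupport h := by
    obtain ⟨R, hR, hb⟩ := hs.isCompact.isBounded.subset_ball_lt 0 z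
    refine ⟨R, hR, fun w hw hm => ?_⟩
    have := hb hm
    rw [Metric.mem_ball, dist_eq, add_sub_cancel_left] at this
    linarith
  have hd : Differentiable ℝ h := hh.differentiable one_ne_zero
  have hfc := hh.continuous_fderiv one_ne_zero
  -- In polar coordinates the Jacobian cancels `1 / |w|` and the integrand becomes `(A + I * B) /
  -- 2`. Here `A` is the radial derivative, and `r * B` the angular one.
  set A : ℝ × ℝ → ℂ := fun p => fderiv ℝ h (z + p.1 * exp (p.2 * I)) (exp (p.2 * I)) with hA
  set B : ℝ × ℝ → ℂ := fun p => fderiv ℝ h (z + p.1 * exp (p.2 * I)) (I * exp (p.2 * I)) with hB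
  have hAc : Continuous A := by fun_prop
  have hBc : Continuous B := by fun_prop
  have hcpt : IsCompact (Icc (0 : ℝ) R ×ˢ Icc (-Real.pi) Real.pi) :=
    isCompact_Icc.prod isCompact_Icc
  have hsub : Ioc (0 : ℝ) R ×ˢ Ioc (-Real.pi) Real.pi ⊆ Icc (0 : ℝ) R ×ˢ Icc (-Real.pi) Real.pi :=
    prod_mono Ioc_subset_Icc_self Ioc_subset_Icc_self
  have hAi : IntegrableOn A (Ioc (0 : ℝ) R ×ˢ Ioc (-Real.pi) Real.pi) (volume.prod volume) :=
    (hAc.continuousOn.integrableOn_compact hcpt).mono_set hsub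
  have hBi : IntegrableOn B (Ioc (0 : ℝ) R ×ˢ Ioc (-Real.pi) Real.pi) (volume.prod volume) :=
    (hBc.continuousOn.integrableOn_compact hcpt).mono_set hsub
  have hpi : -Real.pi ≤ Real.pi := by linarith [Real.pi_pos]
  have hder : ∀ (v : ℝ → ℂ) (v' : ℂ) (t : ℝ), HasDerivAt v v' t →
      HasDerivAt (fun s => h (z + v s)) (fderiv ℝ h (z + v t) v') t := by
    intro v v' t hv
    exact (hd (z + v t)).hasFDerivAt.comp_hasDerivAt t (hv.const_add z)
  have hIA : ∫ p in Ioc (0 : ℝ) R ×ˢ Ioc (-Real.pi) Real.pi, A p ∂(volume.prod volume)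
      = -(2 * Real.pi * h z) := by
    -- Integrated in `r` first, `A` gives `-h z` on every ray, since `h` vanishes at radius `R`.
    rw [← setIntegral_prod_swap, setIntegral_prod]
    · simp only [Prod.swap_prod_mk]
      have : ∀ θ : ℝ, ∫ r in Ioc (0 : ℝ) R, A (r, θ) = -h z := by
        intro θ
        rw [← intervalIntegral.integral_of_le hR.le]
        have hR0 : h (z + (R : ℂ) * exp (θ * I)) = 0 :=
          image_eq_zero_of_notMem_tsupport (hsR _ (by
            simp [norm_exp_ofReal_mul_I, abs_of_pos hR]))
        rw [intervalIntegral.integral_eq_sub_of_hasDerivAt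
          (f := fun r : ℝ => h (z + r * exp (θ * I)))]
        · simp [hR0]
        · intro r _
          refine hder (fun r : ℝ => (r : ℂ) * exp (θ * I)) _ r ?_
          simpa using (hasDerivAt_id r).ofReal_comp.mul_const (exp (θ * I))
        · apply Continuous.intervalIntegrable
          fun_prop
      simp only [this]
      rw [setIntegral_const]
      simp [measureReal_def, Real.volume_Ioc, ENNReal.toReal_ofReal, Real.pi_pos.le]
      exact Or.inl (by ring)
    · rw [IntegrableOn, ← Measure.prod_restrict] at hAi ⊢
      exact hAi.swap
  have hIB : ∫ p in Ioc (0 : ℝ) R ×ˢ Ioc (-Real.pi) Real.pi, B p ∂(volume.prod volume) = 0 := by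
    rw [setIntegral_prod _ hBi]
    refine setIntegral_eq_zero_of_forall_eq_zero fun r hr => ?_
    have hr0 : (r : ℂ) ≠ 0 := by exact_mod_cast hr.1.ne'
    rw [← intervalIntegral.integral_of_le hpi]
    -- `r * B` is the `θ`-derivative of a `2π`-periodic function.
    have : (r : ℂ) * ∫ θ in (-Real.pi)..Real.pi, B (r, θ) = 0 := by
      rw [← intervalIntegral.integral_const_mul, intervalIntegral.integral_eq_sub_of_hasDerivAt
          (f := fun θ : ℝ => h (z + r * exp (θ * I)))]
      · simp [exp_neg]
      · intro θ _
        have h1 : HasDerivAt (fun θ : ℝ => (r : ℂ) * exp (θ * I)) (r • (I * exp (θ * I))) θ := by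
          have := (((hasDerivAt_id θ).ofReal_comp.mul_const I).cexp).const_mul (r : ℂ)
          simpa [mul_comm] using this
        have h2 := hder _ _ _ h1
        rw [map_smul] at h2
        simpa [hB] using h2
      · apply Continuous.intervalIntegrable
        fun_prop
    exact (mul_eq_zero.1 this).resolve_left hr0
  rw [← Complex.integral_comp_polarCoord_symm]
  have hsubset : Ioc (0 : ℝ) R ×ˢ Ioo (-Real.pi) Real.pi ⊆ polarCoord.target :=
    prod_mono Ioc_subset_Ioi_self subset_rfl
  have hpt : ∀ p ∈ polarCoord.target,
      p.1 • (dbar h (z + Complex.polarCoord.symm p) / Complex.polarCoord.symm p)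
        = (A p + I * B p) / 2 := by
    rintro ⟨r, θ⟩ ⟨hr, -⟩
    have hr0 : (r : ℂ) ≠ 0 := by exact_mod_cast (mem_Ioi.1 hr).ne'
    have e : Complex.polarCoord.symm (r, θ) = r * exp (θ * I) := by
      rw [Complex.polarCoord_symm_apply, exp_mul_I]; simp
    rw [e, hA, hB]
    simp only
    rw [← dbar_polar, dbar, real_smul]
    field_simp [exp_ne_zero]
  have hmt : MeasurableSet polarCoord.target := measurableSet_Ioi.prod measurableSet_Ioo
  rw [setIntegral_congr_fun hmt hpt]
  have hz : ∀ p ∈ polarCoord.target \ Ioc (0 : ℝ) R ×ˢ Ioo (-Real.pi) Real.pi,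
      (A p + I * B p) / 2 = 0 := by
    rintro ⟨r, θ⟩ ⟨⟨hr, hθ⟩, h2⟩
    have hrR : R ≤ r := by
      by_contra! hlt
      exact h2 ⟨⟨hr, hlt.le⟩, hθ⟩
    have : fderiv ℝ h (z + r * exp (θ * I)) = 0 := by
      apply image_eq_zero_of_notMem_tsupport
      intro hm
      refine hsR (r * exp (θ * I)) ?_ (tsupport_fderiv_subset ℝ hm)
      simpa [norm_exp_ofReal_mul_I] using hrR.trans (le_abs_self r)
    simp [hA, hB, this]
  rw [setIntegral_eq_of_subset_of_forall_sdiff_eq_zero hmt hsubset hz]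
  have hae : (Ioc (0 : ℝ) R ×ˢ Ioo (-Real.pi) Real.pi : Set (ℝ × ℝ)) =ᵐ[volume.prod volume]
      (Ioc (0 : ℝ) R ×ˢ Ioc (-Real.pi) Real.pi : Set (ℝ × ℝ)) :=
    Measure.set_prod_ae_eq (ae_eq_refl _) Ioo_ae_eq_Ioc
  rw [Measure.volume_eq_prod, setIntegral_congr_set hae, integral_div,
    integral_add hAi (hBi.const_mul I), integral_const_mul, hIA, hIB]
  ring

end LocUniv

/-! ### Polynomial approximation from the Cauchy–Riemann equations almost everywhere -/

namespace LocUniv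

open Set Filter Topology Complex MeasureTheory
open scoped ENNReal

section Resolvent

variable {E : Set ℂ}

/-- The inclusion of `E` into the plane. -/
def coordFun (E : Set ℂ) : C(E, ℂ) := ⟨fun z => z, continuous_subtype_val⟩

/-- The uniform closure on `E` of the polynomial functions. -/
noncomputable def polyClosure (E : Set ℂ) [CompactSpace E] : Subalgebra ℂ C(E, ℂ) :=
  (Algebra.adjoin ℂ {coordFun E}).topologicalClosure

theorem exists_polynomial_of_mem_polyClosure [CompactSpace E] {f : C(E, ℂ)}
    (hf : f ∈ polyClosure E) {ε : ℝ} (hε : 0 < ε) :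
    ∃ p : Polynomial ℂ, ∀ z : E, ‖p.eval (z : ℂ) - f z‖ < ε := by
  obtain ⟨g, hg, hfg⟩ := Metric.mem_closure_iff.1 (show f ∈ closure _ from hf) ε hε
  rw [SetLike.mem_coe, Algebra.adjoin_singleton_eq_range_aeval] at hg
  obtain ⟨p, rfl⟩ := hg
  refine ⟨p, fun z => ?_⟩
  have h1 : (Polynomial.aeval (coordFun E) p : C(E, ℂ)) z = p.eval (z : ℂ) := by
    have := Polynomial.aeval_algHom_apply (ContinuousMap.evalAlgHom ℂ ℂ z) (coordFun E) p
    rw [Polynomial.coe_aeval_eq_eval] at this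
    exact this.symm
  rw [← h1, ← dist_eq, dist_comm]
  exact (ContinuousMap.dist_apply_le_dist z).trans_lt hfg

/-- The resolvent `z ↦ (w - z)⁻¹`. -/
noncomputable def resolventFun (E : Set ℂ) [CompactSpace E] (w : ℂ) : C(E, ℂ) :=
  Ring.inverse (algebraMap ℂ C(E, ℂ) w - coordFun E)

theorem isUnit_algebraMap_sub_coordFun [CompactSpace E] {w : ℂ} (hw : w ∉ E) :
    IsUnit (algebraMap ℂ C(E, ℂ) w - coordFun E) := by
  rw [← spectrum.notMem_iff, ContinuousMap.spectrum_eq_range]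
  rintro ⟨z, rfl⟩
  exact hw z.2

theorem resolventFun_apply [CompactSpace E] {w : ℂ} (hw : w ∉ E) (z : E) :
    resolventFun E w z = (w - z)⁻¹ := by
  have h := Ring.mul_inverse_cancel _ (isUnit_algebraMap_sub_coordFun hw)
  have h2 := DFunLike.congr_fun h z
  exact (inv_eq_of_mul_eq_one_right h2).symm

theorem continuousOn_resolventFun [CompactSpace E] : ContinuousOn (resolventFun E) Eᶜ := by
  intro w hw
  refine ContinuousAt.continuousWithinAt ?_
  obtain ⟨u, hu⟩ := isUnit_algebraMap_sub_coordFun hw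
  have h1 := NormedRing.inverse_continuousAt u
  rw [hu] at h1
  have h2 : ContinuousAt (fun w : ℂ => algebraMap ℂ C(E, ℂ) w - coordFun E) w :=
    ((algebraMapCLM ℂ C(E, ℂ)).continuous.sub continuous_const).continuousAt
  exact ContinuousAt.comp (f := fun w : ℂ => algebraMap ℂ C(E, ℂ) w - coordFun E) h1 h2

/-- Pole pushing: if the complement of `E` is connected, every resolvent is a uniform limit of
polynomials. -/
theorem resolventFun_mem_polyClosure [CompactSpace E] (hc : IsPreconnected Eᶜ) {w : ℂ}
    (hw : w ∉ E) : resolventFun E w ∈ polyClosure E := by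
  have hcl : IsClosed (polyClosure E : Set C(E, ℂ)) := Subalgebra.isClosed_topologicalClosure _
  have hx : coordFun E ∈ polyClosure E :=
    Subalgebra.le_topologicalClosure _ (Algebra.subset_adjoin rfl)
  have hsp : spectrum ℂ (coordFun E) = E := by
    rw [ContinuousMap.spectrum_eq_range]
    exact Subtype.range_coe
  -- As the spectrum `E` in `C(E, ℂ)` has connected complement, it does not grow in the closed
  -- subalgebra; so the inverse of `w - z` already lies there.
  have h := Subalgebra.spectrum_eq_of_isPreconnected_compl (polyClosure E)
    (⟨coordFun E, hx⟩ : polyClosure E) (𝕜 := ℂ) (by simpa [hsp] using hc)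
  have hw' : w ∉ spectrum ℂ (⟨coordFun E, hx⟩ : polyClosure E) := by
    rw [h, hsp]; exact hw
  rw [spectrum.notMem_iff] at hw'
  obtain ⟨v, hv⟩ := hw'.exists_right_inv
  have hv' : (algebraMap ℂ C(E, ℂ) w - coordFun E) * (v : C(E, ℂ)) = 1 :=
    congrArg Subtype.val hv
  have : resolventFun E w = v := by
    have h1 := Ring.inverse_mul_cancel _ (isUnit_algebraMap_sub_coordFun hw)
    calc resolventFun E w = resolventFun E w *
          ((algebraMap ℂ C(E, ℂ) w - coordFun E) * (v : C(E, ℂ))) := by rw [hv', mul_one]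
      _ = v := by rw [← mul_assoc, resolventFun, h1, one_mul]
  rw [this]
  exact v.2

end Resolvent

/-- The average lies in `S` because `S` is closed and convex; multiply back by the volume. -/
theorem setIntegral_mem_of_isClosed {F : Type*} [NormedAddCommGroup F] [NormedSpace ℝ F]
    [CompleteSpace F] {S : Submodule ℝ F} (hS : IsClosed (S : Set F)) {A : Set ℂ}
    (hA : IsCompact A) {f : ℂ → F} (hf : ContinuousOn f A) (hm : ∀ w ∈ A, f w ∈ S) :
    ∫ w in A, f w ∈ S := by
  by_cases h0 : volume A = 0
  · rw [setIntegral_measure_zero _ h0]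
    exact S.zero_mem
  · have h1 := S.convex.set_average_mem hS h0 hA.measure_ne_top
      (ae_restrict_of_forall_mem hA.measurableSet hm) (hf.integrableOn_compact hA)
    rw [setAverage_eq] at h1
    have h2 : (volume.real A) ≠ 0 := by
      rw [measureReal_def]
      exact ENNReal.toReal_ne_zero.2 ⟨h0, hA.measure_ne_top⟩
    have h3 := S.smul_mem (volume.real A) h1
    rwa [smul_inv_smul₀ h2] at h3

theorem setLIntegral_ball_enorm_inv_ne_top (R : ℝ) :
    ∫⁻ w in Metric.ball (0 : ℂ) R, ‖w⁻¹‖ₑ ≠ ∞ := by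
  rw [← lintegral_indicator measurableSet_ball, ← Complex.lintegral_comp_polarCoord_symm]
  have hmt : MeasurableSet polarCoord.target := measurableSet_Ioi.prod measurableSet_Ioo
  have hle : ∫⁻ p in polarCoord.target, ENNReal.ofReal p.1 •
      (Metric.ball (0 : ℂ) R).indicator (fun w => ‖w⁻¹‖ₑ) (Complex.polarCoord.symm p) ≤
      ∫⁻ p in polarCoord.target,
        (Ioo (0 : ℝ) R ×ˢ Ioo (-Real.pi) Real.pi).indicator (fun _ => (1 : ℝ≥0∞)) p := by
    refine setLIntegral_mono' hmt ?_
    rintro ⟨r, θ⟩ ⟨hr, hθ⟩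
    have hr' : 0 < r := hr
    have hn : ‖Complex.polarCoord.symm (r, θ)‖ = r := by
      rw [Complex.norm_polarCoord_symm, abs_of_pos hr']
    by_cases hrR : r < R
    · rw [indicator_of_mem (by rwa [mem_ball_zero_iff, hn]),
        indicator_of_mem (show (r, θ) ∈ Ioo (0 : ℝ) R ×ˢ Ioo (-Real.pi) Real.pi from
          ⟨⟨hr, hrR⟩, hθ⟩)]
      have : ‖(Complex.polarCoord.symm (r, θ))⁻¹‖ₑ = ENNReal.ofReal r⁻¹ := by
        rw [← ofReal_norm, norm_inv, hn]
      rw [this, smul_eq_mul, ← ENNReal.ofReal_mul hr'.le, mul_inv_cancel₀ hr'.ne']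
      simp
    · rw [indicator_of_notMem (by rwa [mem_ball_zero_iff, hn])]
      simp
  refine ne_top_of_le_ne_top ?_ (hle.trans (setLIntegral_le_lintegral _ _))
  rw [lintegral_indicator (measurableSet_Ioo.prod measurableSet_Ioo), setLIntegral_const, one_mul,
    Measure.volume_eq_prod, Measure.prod_prod, Real.volume_Ioo, Real.volume_Ioo]
  exact ENNReal.mul_ne_top ENNReal.ofReal_ne_top ENNReal.ofReal_ne_top

theorem setLIntegral_cauchy_eq (z : ℂ) (B : Set ℂ) :
    ∫⁻ w in B, ‖(w - z)⁻¹‖ₑ = ∫⁻ w in (fun w : ℂ => w + z) ⁻¹' B, ‖w⁻¹‖ₑ := by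
  have := (measurePreserving_add_right (volume : Measure ℂ) z).setLIntegral_comp_preimage_emb
    (measurableEmbedding_addRight z) (fun w => ‖(w - z)⁻¹‖ₑ) B
  simpa using this.symm

theorem preimage_add_right_subset_ball {z : ℂ} {B : Set ℂ} {R : ℝ} (hB : B ⊆ Metric.ball z R) :
    (fun w : ℂ => w + z) ⁻¹' B ⊆ Metric.ball 0 R := by
  intro w hw
  simpa using hB hw

/-- The Cauchy kernel is uniformly absolutely continuous on bounded sets. -/
theorem exists_pos_setLIntegral_cauchy_lt (R : ℝ) {ε : ℝ≥0∞} (hε : ε ≠ 0) :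
    ∃ δ > 0, ∀ (z : ℂ) (B : Set ℂ), MeasurableSet B → B ⊆ Metric.ball z R → volume B < δ →
      ∫⁻ w in B, ‖(w - z)⁻¹‖ₑ < ε := by
  obtain ⟨δ, hδ, h⟩ := exists_pos_setLIntegral_lt_of_measure_lt
    (setLIntegral_ball_enorm_inv_ne_top R) hε
  refine ⟨δ, hδ, fun z B hB hBz hBδ => ?_⟩
  have hpre : MeasurableSet ((fun w : ℂ => w + z) ⁻¹' B) := hB.preimage (by fun_prop)
  have hvol : volume ((fun w : ℂ => w + z) ⁻¹' B) = volume B := measure_preimage_add_right _ z B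
  have h2 := h ((fun w : ℂ => w + z) ⁻¹' B)
    ((Measure.restrict_apply_le _ _).trans_lt (by rwa [hvol]))
  rwa [Measure.restrict_restrict hpre, inter_eq_left.2 (preimage_add_right_subset_ball hBz),
    ← setLIntegral_cauchy_eq] at h2

/-- A continuously differentiable function of compact support which satisfies the Cauchy–Riemann
equations almost everywhere on a compact set with connected complement is a uniform limit of
polynomials there. -/
theorem exists_polynomial_approx_of_dbar {E : Set ℂ} (hE : IsCompact E) (hc : IsPreconnected Eᶜ)
    {h : ℂ → ℂ} (hh : ContDiff ℝ 1 h) (hs : HasCompactSupport h)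
    (h0 : ∀ᵐ w, w ∈ E → dbar h w = 0) {ε : ℝ} (hε : 0 < ε) :
    ∃ p : Polynomial ℂ, ∀ z ∈ E, ‖p.eval z - h z‖ < ε := by
  rcases E.eq_empty_or_nonempty with rfl | hne
  · exact ⟨0, by simp⟩
  have : CompactSpace E := isCompact_iff_compactSpace.1 hE
  have hdc := continuous_dbar hh
  have hds : ∀ w, w ∉ tsupport h → dbar h w = 0 := by
    intro w hw
    have : fderiv ℝ h w = 0 :=
      image_eq_zero_of_notMem_tsupport fun hm => hw (tsupport_fderiv_subset ℝ hm)
    simp [dbar, this]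
  obtain ⟨M, hM⟩ : ∃ M : ℝ, ∀ w, ‖dbar h w‖ ≤ M := by
    refine hdc.bounded_above_of_compact_support ?_
    exact HasCompactSupport.intro hs.isCompact hds
  have hM0 : 0 ≤ M := (norm_nonneg _).trans (hM 0)
  obtain ⟨R, hR, hbound⟩ := exists_subset_closedBall_zero (hE.union hs.isCompact)
  set Q := Metric.closedBall (0 : ℂ) R with hQ
  have hQball : ∀ z ∈ E, Q ⊆ Metric.ball z (2 * R + 1) := by
    intro z hz w hw
    have h1 : ‖z‖ ≤ R := by simpa [hQ] using hbound (Or.inl hz)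
    have h2 : ‖w‖ ≤ R := by simpa [hQ] using hw
    rw [Metric.mem_ball, dist_eq]
    have := norm_sub_le w z
    linarith
  set η : ℝ≥0∞ := ENNReal.ofReal (ε / (M + 1)) with hη
  have hη0 : η ≠ 0 := by
    simp only [hη, ne_eq, ENNReal.ofReal_eq_zero, not_le]
    positivity
  obtain ⟨δ, hδ, hsmall⟩ := exists_pos_setLIntegral_cauchy_lt (2 * R + 1) hη0
  -- Up to the part in `E`, which contributes nothing, the Cauchy–Pompeiu integral splits into a
  -- thin shell `B n` around `E` and a part `A` at positive distance. The shells decrease to the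
  -- empty set, so the shell integral is small uniformly in `z`.
  set B : ℕ → Set ℂ := fun n => Q ∩ {w | w ∉ E ∧ Metric.infDist w E < 1 / ((n : ℝ) + 1)} with hBdef
  have hBm : ∀ n, MeasurableSet (B n) := by
    intro n
    refine Metric.isClosed_closedBall.measurableSet.inter (hE.isClosed.measurableSet.compl.inter ?_)
    exact (isOpen_lt (Metric.continuous_infDist_pt E) continuous_const).measurableSet
  have hBlim : ∃ n, volume (B n) < δ := by
    have hanti : Antitone B := by
      intro m n hmn w hw
      refine ⟨hw.1, hw.2.1, hw.2.2.trans_le ?_⟩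
      exact one_div_le_one_div_of_le (by positivity) (by gcongr)
    have ht := tendsto_measure_iInter_atTop (μ := volume) (fun n => (hBm n).nullMeasurableSet) hanti
      ⟨0, ne_top_of_le_ne_top (isCompact_closedBall (0 : ℂ) R).measure_ne_top
        (measure_mono inter_subset_left)⟩
    have he : ⋂ n, B n = ∅ := by
      refine eq_empty_of_forall_notMem fun w hw => ?_
      rw [mem_iInter] at hw
      have hpos := (hE.isClosed.notMem_iff_infDist_pos hne).1 (hw 0).2.1
      obtain ⟨n, hn⟩ := exists_nat_one_div_lt hpos
      exact lt_asymm hn (hw n).2.2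
    rw [he, measure_empty] at ht
    exact (ht.eventually (gt_mem_nhds hδ)).exists
  obtain ⟨n, hn⟩ := hBlim
  set A : Set ℂ := Q ∩ {w | 1 / ((n : ℝ) + 1) ≤ Metric.infDist w E} with hAdef
  have hAc : IsCompact A := (isCompact_closedBall _ _).inter_right
    (isClosed_le continuous_const (Metric.continuous_infDist_pt E))
  have hAE : A ⊆ Eᶜ := by
    rintro w ⟨-, hw⟩ hwE
    rw [mem_ofPred_eq, Metric.infDist_zero_of_mem hwE] at hw
    have : (0 : ℝ) < 1 / ((n : ℝ) + 1) := by positivity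
    linarith
  set S : Submodule ℝ C(E, ℂ) := (Subalgebra.toSubmodule (polyClosure E)).restrictScalars ℝ with hS
  have hScl : IsClosed (S : Set C(E, ℂ)) := Subalgebra.isClosed_topologicalClosure _
  -- The integral over `A` is read as one of `C(E, ℂ)`-valued multiples of resolvents, hence stays
  -- in `polyClosure E`.
  set g : ℂ → C(E, ℂ) := fun w => (-(dbar h w) / Real.pi) • resolventFun E w with hg
  have hgc : ContinuousOn g A :=
    ((hdc.neg.div_const _).continuousOn).smul (continuousOn_resolventFun.mono hAE)
  have hgm : ∫ w in A, g w ∈ polyClosure E := by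
    refine setIntegral_mem_of_isClosed hScl hAc hgc fun w hw => ?_
    exact (polyClosure E).smul_mem (resolventFun_mem_polyClosure hc (hAE hw)) _
  obtain ⟨p, hp⟩ := exists_polynomial_of_mem_polyClosure hgm (half_pos hε)
  refine ⟨p, fun z hz => ?_⟩
  have hev : (∫ w in A, g w) ⟨z, hz⟩ = ∫ w in A, -(dbar h w) / Real.pi * (w - z)⁻¹ := by
    have := (ContinuousMap.evalCLM ℂ (⟨z, hz⟩ : E)).integral_comp_comm
      (hgc.integrableOn_compact (μ := volume) hAc)
    rw [ContinuousMap.evalCLM_apply] at this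
    rw [← this]
    refine setIntegral_congr_fun hAc.measurableSet fun w hw => ?_
    simp only [hg, ContinuousMap.evalCLM_apply, ContinuousMap.smul_apply, smul_eq_mul]
    rw [resolventFun_apply (hAE hw)]
  set k : ℂ → ℂ := fun w => dbar h w * (w - z)⁻¹ with hk
  have hkle : ∀ T : Set ℂ, ∫⁻ w in T, ‖k w‖ₑ ≤ ENNReal.ofReal M * ∫⁻ w in T, ‖(w - z)⁻¹‖ₑ := by
    intro T
    rw [← lintegral_const_mul' _ _ ENNReal.ofReal_ne_top]
    refine lintegral_mono fun w => ?_
    simp only [hk, enorm_mul]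
    gcongr
    rw [← ofReal_norm]
    exact ENNReal.ofReal_le_ofReal (hM w)
  have hki : IntegrableOn k Q := by
    have hfin : ∫⁻ w in Q, ‖k w‖ₑ < ∞ := by
      refine (hkle Q).trans_lt (ENNReal.mul_lt_top ENNReal.ofReal_lt_top ?_)
      rw [setLIntegral_cauchy_eq]
      exact (lintegral_mono_set (preimage_add_right_subset_ball (hQball z hz))).trans_lt
        (setLIntegral_ball_enorm_inv_ne_top _).lt_top
    exact ⟨(hdc.measurable.mul (by fun_prop)).aestronglyMeasurable, hfin⟩
  have hformula : ∫ w in Q, k w = -(Real.pi * h z) := by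
    rw [← integral_dbar_div hh hs z, setIntegral_eq_integral_of_forall_compl_eq_zero,
      ← integral_add_left_eq_self k z]
    · simp [hk, div_eq_mul_inv]
    · intro w hw
      rw [hk]
      simp only
      rw [hds w fun hm => hw (hbound (Or.inr hm)), zero_mul]
  have hsplit : ∫ w in Q, k w = (∫ w in A, k w) + ∫ w in B n, k w := by
    have hAB : Q \ E = A ∪ B n := by
      ext w
      constructor
      · rintro ⟨h1, h2⟩
        rcases le_or_gt (1 / ((n : ℝ) + 1)) (Metric.infDist w E) with h3 | h3
        · exact Or.inl ⟨h1, h3⟩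
        · exact Or.inr ⟨h1, h2, h3⟩
      · rintro (hw | hw)
        · exact ⟨hw.1, hAE hw⟩
        · exact ⟨hw.1, hw.2.1⟩
    have hdisj : Disjoint A (B n) :=
      disjoint_left.2 fun w h1 h2 => not_lt.2 (show 1 / ((n : ℝ) + 1) ≤ _ from h1.2) h2.2.2
    have hE0 : ∫ w in Q ∩ E, k w = 0 := by
      refine setIntegral_eq_zero_of_ae_eq_zero ?_
      filter_upwards [h0] with w hw hwE
      simp [hk, hw hwE.2]
    rw [← integral_inter_add_sdiff hE.measurableSet hki, hE0, zero_add, hAB,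
      setIntegral_union hdisj (hBm n) (hki.mono_set inter_subset_left)
        (hki.mono_set inter_subset_left)]
  have hBk : ‖∫ w in B n, k w‖ < ε := by
    have h1 := hsmall z (B n) (hBm n) (inter_subset_left.trans (hQball z hz)) hn
    have h2 : ‖∫ w in B n, k w‖ₑ ≤ ENNReal.ofReal M * η :=
      (enorm_integral_le_lintegral_enorm _).trans ((hkle _).trans (by gcongr))
    rw [hη, ← ENNReal.ofReal_mul hM0, ← ofReal_norm,
      ENNReal.ofReal_le_ofReal_iff (by positivity)] at h2
    refine h2.trans_lt ?_
    rw [← mul_div_assoc, div_lt_iff₀ (by linarith)]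
    nlinarith
  have hpi0 : (Real.pi : ℂ) ≠ 0 := by exact_mod_cast Real.pi_ne_zero
  have hAint : (∫ w in A, g w) ⟨z, hz⟩ = h z + (∫ w in B n, k w) / Real.pi := by
    have e1 : (∫ w in A, g w) ⟨z, hz⟩ = -(∫ w in A, k w) / Real.pi := by
      rw [hev, ← integral_neg, ← integral_div]
      refine setIntegral_congr_fun hAc.measurableSet fun w _ => ?_
      simp only [hk]
      ring
    have e2 : ∫ w in A, k w = -(Real.pi * h z) - ∫ w in B n, k w := by
      rw [← hformula, hsplit]; ring
    rw [e1, e2]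
    field_simp
    ring
  have hp' := hp ⟨z, hz⟩
  rw [hAint] at hp'
  have h3 : ‖(∫ w in B n, k w) / (Real.pi : ℂ)‖ < ε / 2 := by
    rw [norm_div, norm_real, Real.norm_of_nonneg Real.pi_pos.le, div_lt_iff₀ Real.pi_pos]
    nlinarith [Real.pi_gt_three]
  calc ‖p.eval z - h z‖ = ‖(p.eval z - (h z + (∫ w in B n, k w) / (Real.pi : ℂ))) +
        (∫ w in B n, k w) / (Real.pi : ℂ)‖ := by congr 1; ring
    _ ≤ _ := norm_add_le _ _
    _ < ε / 2 + ε / 2 := add_lt_add hp' h3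
    _ = ε := add_halves ε

end LocUniv

/-! ### Runge's theorem, injective images and bridges -/

namespace LocUniv

open Set Filter Topology Complex MeasureTheory
open scoped ENNReal Manifold ContDiff

/-- A smooth cutoff function for the compact set `K` inside the open set `U`. -/
theorem exists_cutoff {K U : Set ℂ} (hK : IsCompact K) (hU : IsOpen U) (hKU : K ⊆ U) :
    ∃ χ : ℂ → ℂ, ContDiff ℝ 1 χ ∧ HasCompactSupport χ ∧ tsupport χ ⊆ U ∧
      (∀ᶠ w in 𝓝ˢ K, χ w = 1) ∧ ∀ w, ‖χ w‖ ≤ 1 := by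
  obtain ⟨δ, hδ, hδU⟩ := hK.exists_cthickening_subset_open hU hKU
  obtain ⟨f, hf1, hf0, hf⟩ := exists_contMDiffMap_one_nhds_of_subset_interior 𝓘(ℝ, ℂ) (n := 1)
    hK.isClosed (t := Metric.thickening δ K)
    (by rw [Metric.isOpen_thickening.interior_eq]; exact Metric.self_subset_thickening hδ K)
  have hfd : ContDiff ℝ 1 (f : ℂ → ℝ) := f.contMDiff.contDiff
  have hsub : tsupport (fun w => ((f w : ℝ) : ℂ)) ⊆ Metric.cthickening δ K := by
    refine closure_minimal (fun w hw => ?_) Metric.isClosed_cthickening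
    by_contra hw'
    apply hw
    simp [hf0 w fun h => hw' (Metric.thickening_subset_cthickening _ _ h)]
  refine ⟨fun w => (f w : ℂ), ofRealCLM.contDiff.comp hfd,
    hK.cthickening.of_isClosed_subset (isClosed_tsupport _) hsub, hsub.trans hδU,
    hf1.mono fun w hw => by simp [hw], fun w => ?_⟩
  rw [norm_real, Real.norm_of_nonneg (hf w).1]
  exact (hf w).2

theorem contDiff_cutoff_mul {χ f : ℂ → ℂ} {U : Set ℂ} (hχ : ContDiff ℝ 1 χ) (hU : IsOpen U)
    (hχU : tsupport χ ⊆ U) (hf : DifferentiableOn ℂ f U) :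
    ContDiff ℝ 1 (fun w => χ w * f w) := by
  rw [contDiff_iff_contDiffAt]
  intro w
  by_cases hw : w ∈ U
  · have : ContDiffAt ℂ 1 f w := (hf.analyticAt (hU.mem_nhds hw)).contDiffAt
    exact hχ.contDiffAt.mul (this.restrict_scalars ℝ)
  · have h0 : ∀ᶠ x in 𝓝 w, χ x = 0 := by
      filter_upwards [(isClosed_tsupport χ).isOpen_compl.mem_nhds fun h => hw (hχU h)] with x hx
      exact image_eq_zero_of_notMem_tsupport hx
    refine (contDiffAt_const (c := (0 : ℂ))).congr_of_eventuallyEq ?_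
    filter_upwards [h0] with x hx
    simp [hx]

/-- **Runge's theorem** for compact sets with connected complement. -/
theorem exists_polynomial_approx {K U : Set ℂ} (hK : IsCompact K) (hc : IsPreconnected Kᶜ)
    (hU : IsOpen U) (hKU : K ⊆ U) {f : ℂ → ℂ} (hf : DifferentiableOn ℂ f U) {ε : ℝ}
    (hε : 0 < ε) : ∃ p : Polynomial ℂ, ∀ z ∈ K, ‖p.eval z - f z‖ < ε := by
  obtain ⟨χ, h1, h2, h3, h4, h5⟩ := exists_cutoff hK hU hKU
  rw [eventually_nhdsSet_iff_forall] at h4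
  have h0 : ∀ w ∈ K, dbar (fun w => χ w * f w) w = 0 := by
    intro w hw
    refine dbar_eq_zero_of_differentiableAt ?_
    refine (hf.differentiableAt (hU.mem_nhds (hKU hw))).congr_of_eventuallyEq ?_
    filter_upwards [h4 w hw] with x hx
    simp [hx]
  obtain ⟨p, hp⟩ := exists_polynomial_approx_of_dbar hK hc (contDiff_cutoff_mul h1 hU h3 hf)
    h2.mul_right (Eventually.of_forall h0) hε
  refine ⟨p, fun z hz => ?_⟩
  have := hp z hz
  rwa [(h4 z hz).self_of_nhds, one_mul] at this

/-- The polynomial splits into linear factors with roots off `K`, each of which has a logarithm. -/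
theorem hasContLog_polynomial {K : Set ℂ} (hK : IsCompact K) (hc : IsPreconnected Kᶜ)
    {p : Polynomial ℂ} (hp : p ≠ 0) (h0 : ∀ z ∈ K, p.eval z ≠ 0) :
    HasContLog (fun z => p.eval z) K := by
  have hprod : ∀ s : Multiset ℂ, (∀ a ∈ s, a ∉ K) →
      HasContLog (fun z => (s.map fun a => z - a).prod) K := by
    intro s
    induction s using Multiset.induction_on with
    | empty => intro _; simpa using hasContLog_const one_ne_zero K
    | cons a s ih =>
      intro hs
      simp only [Multiset.map_cons, Multiset.prod_cons]
      exact (hasContLog_sub_of_isPreconnected_compl hK hc (hs a (by simp))).mul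
        (ih fun b hb => hs b (Multiset.mem_cons_of_mem hb))
  refine ((hasContLog_const (Polynomial.leadingCoeff_ne_zero.2 hp) K).mul
    (hprod p.roots fun a ha haK => ?_)).congr fun z _ => ?_
  · exact h0 a haK (Polynomial.isRoot_of_mem_roots ha)
  · exact ((IsAlgClosed.splits p).eval_eq_prod_roots z).symm

/-- A nonvanishing holomorphic function near a compact set with connected complement has a
continuous logarithm on this set. -/
theorem hasContLog_of_differentiableOn {K U : Set ℂ} (hK : IsCompact K) (hc : IsPreconnected Kᶜ)
    (hU : IsOpen U) (hKU : K ⊆ U) {f : ℂ → ℂ} (hf : DifferentiableOn ℂ f U)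
    (h0 : ∀ z ∈ K, f z ≠ 0) : HasContLog f K := by
  rcases K.eq_empty_or_nonempty with rfl | hne
  · exact ⟨fun _ => 0, by simp, by simp⟩
  have hfc : ContinuousOn f K := hf.continuousOn.mono hKU
  obtain ⟨z₀, hz₀, hmin⟩ := hK.exists_isMinOn hne hfc.norm
  have hm : 0 < ‖f z₀‖ := norm_pos_iff.2 (h0 z₀ hz₀)
  -- With error below half the minimum of `‖f‖`, `p` is zero-free on `K` and `f = p (1 + (f - p) /
  -- p)` with a quotient of norm less than one.
  obtain ⟨p, hp⟩ := exists_polynomial_approx hK hc hU hKU hf (half_pos hm)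
  have hlow : ∀ z ∈ K, ‖f z₀‖ / 2 < ‖p.eval z‖ := by
    intro z hz
    have h1 : ‖f z₀‖ ≤ ‖f z‖ := hmin hz
    have h2 := hp z hz
    have h3 := norm_sub_norm_le (f z) (p.eval z)
    rw [norm_sub_rev] at h3
    linarith
  have hp0 : ∀ z ∈ K, p.eval z ≠ 0 := fun z hz =>
    norm_pos_iff.1 ((half_pos hm).trans (hlow z hz))
  have hpne : p ≠ 0 := by
    rintro rfl
    exact hp0 z₀ hz₀ (by simp)
  refine ((hasContLog_polynomial hK hc hpne hp0).mul (hasContLog_one_add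
    (u := fun z => (f z - p.eval z) / p.eval z) ?_ ?_)).congr fun z hz => ?_
  · exact (hfc.sub p.continuous.continuousOn).div p.continuous.continuousOn hp0
  · intro z hz
    rw [norm_div, div_lt_one (norm_pos_iff.2 (hp0 z hz)), norm_sub_rev]
    exact (hp z hz).trans (hlow z hz)
  · have := hp0 z hz
    field_simp
    ring

/-- The holomorphic inverse of an injective holomorphic function. -/
theorem exists_inverse {U : Set ℂ} (hU : IsOpen U) {φ : ℂ → ℂ} (hφ : DifferentiableOn ℂ φ U)
    (hinj : InjOn φ U) (h0 : ∀ z ∈ U, deriv φ z ≠ 0) :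
    ∃ ψ : ℂ → ℂ, IsOpen (φ '' U) ∧ DifferentiableOn ℂ ψ (φ '' U) ∧ ∀ z ∈ U, ψ (φ z) = z := by
  have hst : ∀ z ∈ U, HasStrictDerivAt φ (deriv φ z) z := fun z hz =>
    (hφ.analyticAt (hU.mem_nhds hz)).hasStrictDerivAt
  have hinv : ∀ z ∈ U, Function.invFunOn φ U (φ z) = z := fun z hz => hinj.leftInvOn_invFunOn hz
  refine ⟨Function.invFunOn φ U, ?_, ?_, hinv⟩
  · rw [isOpen_iff_mem_nhds]
    rintro _ ⟨z, hz, rfl⟩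
    rw [← (hst z hz).map_nhds_eq (h0 z hz)]
    exact image_mem_map (hU.mem_nhds hz)
  · rintro _ ⟨z, hz, rfl⟩
    refine ((hst z hz).to_local_left_inverse (h0 z hz) ?_).hasDerivAt.differentiableAt
      |>.differentiableWithinAt
    filter_upwards [hU.mem_nhds hz] with x hx using hinv x hx

/-- An injective holomorphic function preserves the connectedness of the complement of a compact
set. -/
theorem isPreconnected_compl_image {K U : Set ℂ} (hK : IsCompact K) (hc : IsPreconnected Kᶜ)
    (hU : IsOpen U) (hKU : K ⊆ U) {φ : ℂ → ℂ} (hφ : DifferentiableOn ℂ φ U)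
    (hinj : InjOn φ U) (h0 : ∀ z ∈ U, deriv φ z ≠ 0) : IsPreconnected (φ '' K)ᶜ := by
  obtain ⟨ψ, hopen, hψ, hinv⟩ := exists_inverse hU hφ hinj h0
  refine isPreconnected_compl_of_log (hK.image_of_continuousOn (hφ.continuousOn.mono hKU))
    fun a ha => ?_
  -- A logarithm of `φ - a` on `K`, composed with the inverse of `φ`, is one of `w - a` on `φ '' K`.
  obtain ⟨h, hhc, he⟩ := hasContLog_of_differentiableOn hK hc hU hKU (hφ.sub_const a)
    fun z hz h => ha ⟨z, hz, sub_eq_zero.1 h⟩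
  refine ⟨fun w => h (ψ w), ?_, ?_⟩
  · refine hhc.comp (hψ.continuousOn.mono (image_mono hKU)) ?_
    rintro _ ⟨z, hz, rfl⟩
    rwa [hinv z (hKU hz)]
  · rintro _ ⟨z, hz, rfl⟩
    simp only [hinv z (hKU hz)]
    exact he z hz

/-- At the only possible common point the two logarithms differ by a period of `exp`; shifting one
by this constant makes them agree. -/
theorem HasContLog.union_of_inter_subset_singleton {f : ℂ → ℂ} {K T : Set ℂ} {k : ℂ}
    (hK : IsClosed K) (hT : IsClosed T) (hKT : K ∩ T ⊆ {k}) (hkK : k ∈ K) (hkT : k ∈ T)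
    (h1 : HasContLog f K) (h2 : HasContLog f T) : HasContLog f (K ∪ T) := by
  obtain ⟨u, huc, hu⟩ := h1
  obtain ⟨v, hvc, hv⟩ := h2
  classical
  set v' : ℂ → ℂ := fun z => v z + (u k - v k) with hv'
  have hv'e : ∀ z ∈ T, exp (v' z) = f z := by
    intro z hz
    rw [hv', exp_add, exp_sub, hu k hkK, hv z hz, hv k hkT, div_self, mul_one]
    rw [← hv k hkT]
    exact exp_ne_zero _
  have hT' : ∀ z ∈ T, K.piecewise u v' z = v' z := by
    intro z hz
    by_cases hzK : z ∈ K
    · obtain rfl : z = k := hKT ⟨hzK, hz⟩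
      simp [hv', hzK]
    · simp [hzK]
  have hK' : ∀ z ∈ K, K.piecewise u v' z = u z := fun z hz => by simp [hz]
  refine ⟨K.piecewise u v', ?_, ?_⟩
  · exact (huc.congr hK').union_of_isClosed ((hvc.add continuousOn_const).congr hT') hK hT
  · rintro z (hz | hz)
    · rw [hK' z hz, hu z hz]
    · rw [hT' z hz, hv'e z hz]

theorem hasContLog_segment {k l a : ℂ} (hkl : k ≠ l) (ha : a ∉ segment ℝ k l) :
    HasContLog (fun w => w - a) (segment ℝ k l) := by
  -- Clamping to `[0, 1]` extends the parametrisation to the simply connected line, where a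
  -- logarithm exists.
  set c : ℝ → ℝ := fun t => max 0 (min 1 t) with hc
  have hseg : ∀ t, k + c t * (l - k) ∈ segment ℝ k l := by
    intro t
    rw [segment_eq_image']
    exact ⟨c t, ⟨le_max_left _ _, max_le zero_le_one (min_le_left _ _)⟩, by simp⟩
  have hsc : IsSimplyConnected (univ : Set ℝ) := by
    have : ContractibleSpace (univ : Set ℝ) := convex_univ.contractibleSpace univ_nonempty
    exact (inferInstance : SimplyConnectedSpace (univ : Set ℝ))
  obtain ⟨H, hHc, hH⟩ := exists_continuousOn_eqOn_exp_comp (X := ℝ) (U := univ)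
    (g := fun t => k + c t * (l - k) - a) hsc isOpen_univ (by fun_prop)
    (by rintro ⟨t, -, ht⟩; exact ha (sub_eq_zero.1 ht ▸ hseg t))
  rw [continuousOn_univ] at hHc
  refine ⟨fun w => H ((w - k) / (l - k)).re, by fun_prop, ?_⟩
  intro w hw
  rw [segment_eq_image'] at hw
  obtain ⟨t, ht, rfl⟩ := hw
  have hne : l - k ≠ 0 := sub_ne_zero.2 hkl.symm
  have e : ((k + t • (l - k) - k) / (l - k)).re = t := by
    rw [add_sub_cancel_left, real_smul, mul_div_assoc, div_self hne, mul_one, ofReal_re]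
  have hct : c t = t := by simp [hc, ht.1, ht.2]
  simp only [e]
  have := hH (mem_univ t)
  simpa [hct] using this

/-- Two disjoint compact sets with connected complements, joined by a segment between nearest
points, form a compact set with connected complement. -/
theorem isPreconnected_compl_bridge {K L : Set ℂ} (hK : IsCompact K) (hL : IsCompact L)
    (hKc : IsPreconnected Kᶜ) (hLc : IsPreconnected Lᶜ) (hKL : Disjoint K L) {k l : ℂ}
    (hk : k ∈ K) (hl : l ∈ L) (hmin : ∀ x ∈ K, ∀ y ∈ L, dist k l ≤ dist x y) :
    IsPreconnected (K ∪ segment ℝ k l ∪ L)ᶜ := by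
  have hkl : k ≠ l := fun h => disjoint_left.1 hKL hk (h ▸ hl)
  have hS : IsCompact (segment ℝ k l) := by
    rw [segment_eq_image']
    exact isCompact_Icc.image (by fun_prop)
  refine isPreconnected_compl_of_log ((hK.union hS).union hL) fun a ha => ?_
  simp only [mem_union, not_or] at ha
  -- Since `k` and `l` are nearest points, the segment meets `K` only in `k` and `L` only in `l`, so
  -- logarithms glue twice.
  refine HasContLog.union_of_inter_subset_singleton (k := l) (hK.union hS).isClosed hL.isClosed
    ?_ (Or.inr (right_mem_segment ℝ k l)) hl
    (HasContLog.union_of_inter_subset_singleton (k := k) hK.isClosed hS.isClosed ?_ hk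
      (left_mem_segment ℝ k l) (hasContLog_sub_of_isPreconnected_compl hK hKc ha.1.1)
      (hasContLog_segment hkl ha.1.2)) (hasContLog_sub_of_isPreconnected_compl hL hLc ha.2)
  · rintro x ⟨hx | hx, hxL⟩
    · exact (disjoint_left.1 hKL hx hxL).elim
    · have h1 := dist_add_dist_of_mem_segment hx
      have h2 := hmin k hk x hxL
      exact dist_le_zero.1 (by linarith)
  · rintro x ⟨hxK, hx⟩
    have h1 := dist_add_dist_of_mem_segment hx
    have h2 := hmin x hxK l hl
    exact (dist_le_zero.1 (by linarith : dist k x ≤ 0)).symm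

end LocUniv

/-! ### Entire functions with zero-free derivative across a bridge -/

namespace LocUniv

open Set Filter Topology Complex MeasureTheory
open scoped ENNReal

theorem norm_exp_sub_exp_le {p s : ℂ} {M : ℝ} (hs : ‖s‖ ≤ M) (hps : ‖p - s‖ ≤ 1) :
    ‖exp p - exp s‖ ≤ Real.exp M * (2 * ‖p - s‖) := by
  have e : exp p - exp s = exp s * (exp (p - s) - 1) := by
    rw [mul_sub, ← exp_add]; ring_nf
  rw [e, norm_mul]
  gcongr
  · exact (norm_exp_le_exp_norm s).trans (Real.exp_le_exp.2 hs)
  · exact norm_exp_sub_one_le hps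

/-- Cutoffs of `f` to shrinking neighbourhoods of `K` are bounded, and they vanish eventually at
every point outside of `K`. -/
theorem exists_shrinking_cutoffs {K U : Set ℂ} (hK : IsCompact K) (hU : IsOpen U) (hKU : K ⊆ U)
    {f : ℂ → ℂ} (hf : DifferentiableOn ℂ f U) :
    ∃ (q : ℕ → ℂ → ℂ) (M : ℝ), (∀ n, ContDiff ℝ 1 (q n)) ∧ (∀ n, HasCompactSupport (q n)) ∧
      (∀ n, tsupport (q n) ⊆ U) ∧ (∀ n, ∀ z ∈ K, ∀ᶠ w in 𝓝 z, q n w = f w) ∧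
      (∀ n w, ‖q n w‖ ≤ M) ∧ ∀ w ∉ K, ∀ᶠ n in atTop, q n w = 0 := by
  obtain ⟨δ, hδ, hδU⟩ := hK.exists_cthickening_subset_open hU hKU
  obtain ⟨M, hM⟩ := hK.cthickening.exists_bound_of_continuousOn (hf.continuousOn.mono hδU)
  have hpos : ∀ n : ℕ, 0 < δ / ((n : ℝ) + 1) := fun n => by positivity
  have hsub : ∀ n : ℕ, Metric.thickening (δ / ((n : ℝ) + 1)) K ⊆ Metric.cthickening δ K :=
    fun n => (Metric.thickening_mono (div_le_self hδ.le (by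
      have : (0 : ℝ) ≤ n := n.cast_nonneg
      linarith)) K).trans
      (Metric.thickening_subset_cthickening _ _)
  choose χ h1 h2 h3 h4 h5 using fun n : ℕ => exists_cutoff hK
    (Metric.isOpen_thickening (δ := δ / ((n : ℝ) + 1)) (E := K))
    (Metric.self_subset_thickening (hpos n) K)
  have h3' : ∀ n, tsupport (χ n) ⊆ U := fun n => (h3 n).trans ((hsub n).trans hδU)
  refine ⟨fun n w => χ n w * f w, max M 0, fun n => contDiff_cutoff_mul (h1 n) hU (h3' n) hf,
    fun n => (h2 n).mul_right, fun n => ?_, fun n z hz => ?_, fun n w => ?_, fun w hw => ?_⟩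
  · exact (tsupport_mul_subset_left).trans (h3' n)
  · filter_upwards [eventually_nhdsSet_iff_forall.1 (h4 n) z hz] with w hw
    simp [hw]
  · by_cases hw : w ∈ tsupport (χ n)
    · rw [norm_mul]
      have := hM w (hsub n (h3 n hw))
      calc ‖χ n w‖ * ‖f w‖ ≤ 1 * M := by
            gcongr
            exact h5 n w
        _ ≤ max M 0 := by simp
    · simp [image_eq_zero_of_notMem_tsupport hw]
  · rcases K.eq_empty_or_nonempty with rfl | hne
    · refine Eventually.of_forall fun n => ?_
      have h0 : w ∉ tsupport (χ n) := fun h => by simpa using h3 n h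
      simp [image_eq_zero_of_notMem_tsupport h0]
    have hd := (hK.isClosed.notMem_iff_infDist_pos hne).1 hw
    have ht : Tendsto (fun n : ℕ => δ / ((n : ℝ) + 1)) atTop (𝓝 0) :=
      tendsto_const_nhds.div_atTop (tendsto_natCast_atTop_atTop.atTop_add tendsto_const_nhds)
    filter_upwards [ht.eventually (gt_mem_nhds hd)] with n hn
    have h0 : w ∉ tsupport (χ n) := fun h => by
      have := h3 n h
      rw [Metric.mem_thickening_iff_infDist_lt hne] at this
      linarith
    simp [image_eq_zero_of_notMem_tsupport h0]

theorem volume_segment (k l : ℂ) : volume (segment ℝ k l) = 0 := by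
  have h : affineSpan ℝ {k, l} ≠ ⊤ := by
    intro h
    have h1 := collinear_iff_finrank_le_one.1 (collinear_pair ℝ k l)
    rw [← direction_affineSpan, h, AffineSubspace.direction_top, finrank_top,
      Complex.finrank_real_complex] at h1
    omega
  refine measure_mono_null ?_ (Measure.addHaar_affineSubspace volume _ h)
  rw [← convexHull_pair]
  exact convexHull_subset_affineSpan _

/-- Let `K` and `L` be disjoint compact sets with connected complements and nearest points `k` and
`l`. There is an entire function `G` with zero-free derivative `exp p` whose derivative is
prescribed approximately on `K` and `L`, and whose values are prescribed at `k` and `l`. -/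
theorem exists_entire_bridge {K L U V : Set ℂ} (hK : IsCompact K) (hL : IsCompact L)
    (hKc : IsPreconnected Kᶜ) (hLc : IsPreconnected Lᶜ) (hKL : Disjoint K L) {k l : ℂ}
    (hk : k ∈ K) (hl : l ∈ L) (hmin : ∀ x ∈ K, ∀ y ∈ L, dist k l ≤ dist x y)
    (hU : IsOpen U) (hKU : K ⊆ U) (hV : IsOpen V) (hLV : L ⊆ V) {a b : ℂ → ℂ}
    (ha : DifferentiableOn ℂ a U) (hb : DifferentiableOn ℂ b V) (α β : ℂ) {ε : ℝ} (hε : 0 < ε) :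
    ∃ G p : ℂ → ℂ, (∀ z, HasDerivAt G (exp (p z)) z) ∧ (∀ z ∈ K, ‖exp (p z) - exp (a z)‖ < ε) ∧
      (∀ z ∈ L, ‖exp (p z) - exp (b z)‖ < ε) ∧ G k = α ∧ ‖G l - β‖ < ε := by
  have hkl : k ≠ l := fun h => disjoint_left.1 hKL hk (h ▸ hl)
  have hlk0 : l - k ≠ 0 := sub_ne_zero.2 hkl.symm
  set d := ‖l - k‖ with hd
  have hd0 : 0 < d := norm_pos_iff.2 hlk0
  -- The increment `β' - α` is to equal `(l - k) * exp c`, so it must not vanish; if `β = α`, the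
  -- target is moved slightly.
  obtain ⟨β', hβ'α, hβ'⟩ : ∃ β', β' ≠ α ∧ ‖β' - β‖ < ε / 3 := by
    by_cases h : β = α
    · refine ⟨β + (ε / 4 : ℝ), ?_, ?_⟩
      · rw [h]
        intro h2
        have : ((ε / 4 : ℝ) : ℂ) = 0 := by simpa using h2
        rw [ofReal_eq_zero] at this
        linarith
      · rw [add_sub_cancel_left, norm_real, Real.norm_of_nonneg (by linarith)]
        linarith
    · exact ⟨β, h, by simpa using by linarith⟩
  set c := log ((β' - α) / (l - k)) with hcdef
  have hc : (l - k) * exp c = β' - α := by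
    rw [hcdef, exp_log (div_ne_zero (sub_ne_zero.2 hβ'α) hlk0), mul_div_cancel₀ _ hlk0]
  obtain ⟨q, M, q1, q2, q3, q4, q5, q6⟩ := exists_shrinking_cutoffs hK
    (hU.inter hL.isClosed.isOpen_compl)
    (subset_inter hKU fun z hz hz' => disjoint_left.1 hKL hz hz')
    (f := fun z => a z - c) ((ha.mono inter_subset_left).sub_const c)
  obtain ⟨r, N, r1, r2, r3, r4, r5, r6⟩ := exists_shrinking_cutoffs hL
    (hV.inter hK.isClosed.isOpen_compl)
    (subset_inter hLV fun z hz hz' => disjoint_left.1 hKL hz' hz)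
    (f := fun z => b z - c) ((hb.mono inter_subset_left).sub_const c)
  have hqL : ∀ n, ∀ z ∈ L, ∀ᶠ w in 𝓝 z, q n w = 0 := by
    intro n z hz
    filter_upwards [(isClosed_tsupport (q n)).isOpen_compl.mem_nhds
      (fun h => (q3 n h).2 hz)] with w hw using image_eq_zero_of_notMem_tsupport hw
  have hrK : ∀ n, ∀ z ∈ K, ∀ᶠ w in 𝓝 z, r n w = 0 := by
    intro n z hz
    filter_upwards [(isClosed_tsupport (r n)).isOpen_compl.mem_nhds
      (fun h => (r3 n h).2 hz)] with w hw using image_eq_zero_of_notMem_tsupport hw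
  set γ : ℝ → ℂ := fun t => k + t * (l - k) with hγ
  have hγs : ∀ t ∈ Icc (0 : ℝ) 1, γ t ∈ segment ℝ k l := by
    intro t ht
    rw [segment_eq_image']
    exact ⟨t, ht, by simp [hγ]⟩
  have hγK : ∀ t ∈ Ioo (0 : ℝ) 1, γ t ∉ K := by
    intro t ht h
    have h1 := hmin _ h l hl
    rw [dist_eq, dist_eq, show γ t - l = ((1 - t : ℝ) : ℂ) * (k - l) by simp [hγ]; ring, norm_mul,
      norm_real, Real.norm_of_nonneg (by linarith [ht.2]), norm_sub_rev] at h1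
    nlinarith [ht.1]
  have hγL : ∀ t ∈ Ioo (0 : ℝ) 1, γ t ∉ L := by
    intro t ht h
    have h1 := hmin k hk _ h
    rw [dist_eq, dist_eq, show k - γ t = (t : ℂ) * (k - l) by simp [hγ]; ring, norm_mul,
      norm_real, Real.norm_of_nonneg ht.1.le, norm_sub_rev] at h1
    nlinarith [ht.2]
  -- `s n` equals `a` on `K` and `b` on `L`, is bounded uniformly in `n`, and is eventually `c` at
  -- each point of the open segment. By dominated convergence the integral of `exp (s n)` along the
  -- segment tends to `exp c`.
  set s : ℕ → ℂ → ℂ := fun n w => c + (q n w + r n w) with hs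
  have hsb : ∀ n w, ‖s n w‖ ≤ ‖c‖ + (M + N) := fun n w =>
    (norm_add_le _ _).trans (add_le_add le_rfl ((norm_add_le _ _).trans
      (add_le_add (q5 n w) (r5 n w))))
  have hsc : ∀ n, Continuous (s n) := fun n =>
    continuous_const.add ((q1 n).continuous.add (r1 n).continuous)
  have hγc : Continuous γ := by fun_prop
  have hlim : Tendsto (fun n => ∫ t in (0 : ℝ)..1, exp (s n (γ t))) atTop
      (𝓝 (∫ _ in (0 : ℝ)..1, exp c)) := by
    refine intervalIntegral.tendsto_integral_filter_of_dominated_convergence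
      (fun _ => Real.exp (‖c‖ + (M + N))) ?_ ?_ (by simp) ?_
    · exact Eventually.of_forall fun n =>
        ((continuous_exp.comp ((hsc n).comp hγc))).aestronglyMeasurable
    · refine Eventually.of_forall fun n => Eventually.of_forall fun t _ => ?_
      exact (norm_exp_le_exp_norm _).trans (Real.exp_le_exp.2 (hsb n _))
    · have h1 : ∀ᵐ t : ℝ, t ≠ 1 := by simp [ae_iff]
      filter_upwards [h1] with t ht1 ht
      rw [uIoc_of_le zero_le_one] at ht
      have ht' : t ∈ Ioo (0 : ℝ) 1 := ⟨ht.1, lt_of_le_of_ne ht.2 ht1⟩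
      refine tendsto_const_nhds.congr' ?_
      filter_upwards [q6 _ (hγK t ht'), r6 _ (hγL t ht')] with n hn1 hn2
      simp [hs, hn1, hn2]
  rw [intervalIntegral.integral_const, sub_zero, one_smul] at hlim
  obtain ⟨n, hn⟩ := ((Metric.tendsto_nhds.1 hlim) (ε / (3 * d)) (by positivity)).exists
  rw [dist_eq] at hn
  set E := K ∪ segment ℝ k l ∪ L with hE
  have hEc : IsCompact E := by
    refine (hK.union ?_).union hL
    rw [segment_eq_image']
    exact isCompact_Icc.image (by fun_prop)
  have hEp : IsPreconnected Eᶜ := isPreconnected_compl_bridge hK hL hKc hLc hKL hk hl hmin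
  set C := Real.exp (‖c‖ + (M + N)) with hC
  have hC0 : 0 < C := Real.exp_pos _
  -- Then `C * (2 * η)` is at most `ε / (3 * (d + 1))`, which is below both `ε / (3 * d)` and `ε`.
  set η := min 1 (ε / (6 * C * (d + 1))) with hη
  have hη0 : 0 < η := lt_min one_pos (by positivity)
  have hdbar : ∀ᵐ w, w ∈ E → dbar (fun w => q n w + r n w) w = 0 := by
    have : ∀ᵐ w : ℂ, w ∉ segment ℝ k l := by
      rw [ae_iff]
      simpa using volume_segment k l
    filter_upwards [this] with w hw hwE
    refine dbar_eq_zero_of_differentiableAt ?_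
    rcases hwE with (hwK | hwS) | hwL
    · refine ((ha.differentiableAt (hU.mem_nhds (hKU hwK))).sub_const c).congr_of_eventuallyEq ?_
      filter_upwards [q4 n w hwK, hrK n w hwK] with x hx1 hx2
      simp [hx1, hx2]
    · exact (hw hwS).elim
    · refine ((hb.differentiableAt (hV.mem_nhds (hLV hwL))).sub_const c).congr_of_eventuallyEq ?_
      filter_upwards [r4 n w hwL, hqL n w hwL] with x hx1 hx2
      simp [hx1, hx2]
  obtain ⟨P, hP⟩ := exists_polynomial_approx_of_dbar hEc hEp ((q1 n).add (r1 n))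
    ((q2 n).add (r2 n)) hdbar hη0
  set p : ℂ → ℂ := fun z => c + P.eval z with hp
  have hpd : Differentiable ℂ p := P.differentiable.const_add c
  have hps : ∀ z ∈ E, ‖exp (p z) - exp (s n z)‖ < ε / (3 * d) ∧
      ‖exp (p z) - exp (s n z)‖ < ε := by
    intro z hz
    have h1 : ‖p z - s n z‖ < η := by
      have := hP z hz
      simpa [hp, hs] using this
    have h2 := norm_exp_sub_exp_le (hsb n z) (h1.le.trans (min_le_left _ _))
    have h3 : ‖p z - s n z‖ < ε / (6 * C * (d + 1)) := h1.trans_le (min_le_right _ _)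
    have h4 : ‖exp (p z) - exp (s n z)‖ < ε / (3 * (d + 1)) := by
      refine h2.trans_lt ?_
      calc C * (2 * ‖p z - s n z‖) < C * (2 * (ε / (6 * C * (d + 1)))) := by gcongr
        _ = ε / (3 * (d + 1)) := by field_simp; ring
    refine ⟨h4.trans_le ?_, h4.trans_le ?_⟩
    · gcongr
      linarith
    · rw [div_le_iff₀ (by positivity)]
      nlinarith
  obtain ⟨G, hGk, hG⟩ := (Differentiable.isExactOn_univ (f := fun z => exp (p z))
    hpd.cexp).with_val_at k α
  refine ⟨G, p, fun z => hG z (mem_univ z), fun z hz => ?_, fun z hz => ?_, hGk, ?_⟩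
  · have h1 := (hps z (Or.inl (Or.inl hz))).2
    have : s n z = a z := by
      simp [hs, (q4 n z hz).self_of_nhds, (hrK n z hz).self_of_nhds]
    rwa [this] at h1
  · have h1 := (hps z (Or.inr hz)).2
    have : s n z = b z := by
      simp [hs, (r4 n z hz).self_of_nhds, (hqL n z hz).self_of_nhds]
    rwa [this] at h1
  have hFTC : ∫ t in (0 : ℝ)..1, exp (p (γ t)) * (l - k) = G l - α := by
    have hcont : Continuous fun t => exp (p (γ t)) * (l - k) := by
      have := hpd.continuous
      fun_prop
    rw [intervalIntegral.integral_eq_sub_of_hasDerivAt (f := fun t => G (γ t))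
      (fun t _ => ?_) (hcont.intervalIntegrable _ _)]
    · simp [hγ, hGk]
    · have h1 : HasDerivAt γ (l - k) t := by
        have := ((hasDerivAt_id t).ofReal_comp.mul_const (l - k)).const_add k
        rw [ofReal_one, one_mul] at this
        exact this
      exact HasDerivAt.comp (h := γ) t (hG (γ t) (mem_univ _)) h1
  rw [intervalIntegral.integral_mul_const] at hFTC
  have hpc : Continuous fun t => exp (p (γ t)) := by
    have := hpd.continuous
    fun_prop
  have hsn : Continuous fun t => exp (s n (γ t)) := by
    have := hsc n
    fun_prop
  have hdiff : ‖(∫ t in (0 : ℝ)..1, exp (p (γ t))) - ∫ t in (0 : ℝ)..1, exp (s n (γ t))‖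
      ≤ ε / (3 * d) := by
    rw [← intervalIntegral.integral_sub (hpc.intervalIntegrable _ _) (hsn.intervalIntegrable _ _)]
    have := intervalIntegral.norm_integral_le_of_norm_le_const (a := (0 : ℝ)) (b := 1)
      (C := ε / (3 * d)) (f := fun t => exp (p (γ t)) - exp (s n (γ t))) fun t ht => by
        rw [uIoc_of_le zero_le_one] at ht
        exact (hps _ (Or.inl (Or.inr (hγs t (Ioc_subset_Icc_self ht))))).1.le
    simpa using this
  set I₁ := ∫ t in (0 : ℝ)..1, exp (p (γ t)) with hI₁
  set I₂ := ∫ t in (0 : ℝ)..1, exp (s n (γ t)) with hI₂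
  -- The three errors, each at most `ε / 3`, come from the polynomial, the cutoffs and the shift to
  -- `β'`.
  have e : G l - β = ((I₁ - I₂) * (l - k) + (I₂ - exp c) * (l - k)) + (β' - β) := by
    linear_combination -hFTC + hc
  have hd3 : ε / (3 * d) * d = ε / 3 := by field_simp
  calc ‖G l - β‖ ≤ (‖I₁ - I₂‖ * d + ‖I₂ - exp c‖ * d) + ‖β' - β‖ := by
        rw [e]
        refine (norm_add_le _ _).trans (add_le_add ((norm_add_le _ _).trans ?_) le_rfl)
        rw [norm_mul, norm_mul]
    _ < (ε / (3 * d) * d + ε / (3 * d) * d) + ε / 3 :=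
        add_lt_add (add_lt_add_of_le_of_lt (mul_le_mul_of_nonneg_right hdiff hd0.le)
          (mul_lt_mul_of_pos_right hn hd0)) hβ'
    _ = ε := by rw [hd3]; ring

end LocUniv

/-! ### Oscillation bounds and topological transitivity -/

namespace LocUniv

open Set Filter Topology Complex

/-- On the compact set `T ⊆ Ω`, the deviation of a holomorphic function from its value at `z₀ ∈ T`
is controlled by its derivative on `T`. -/
def OscBound (Ω : Opens ℂ) (z₀ : ℂ) (T : Set ℂ) : Prop :=
  IsCompact T ∧ T ⊆ Ω ∧ z₀ ∈ T ∧ ∃ C : ℝ, ∀ (F : ℂ → ℂ) (M : ℝ), DifferentiableOn ℂ F Ω →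
    (∀ z ∈ T, ‖deriv F z‖ ≤ M) → ∀ z ∈ T, ‖F z - F z₀‖ ≤ C * M

section OscBound

variable {Ω : Opens ℂ} {z₀ : ℂ} {T T' : Set ℂ}

theorem oscBound_singleton (hz₀ : z₀ ∈ Ω) : OscBound Ω z₀ {z₀} :=
  ⟨isCompact_singleton, by simpa using hz₀, rfl, 0, fun F M _ _ z hz => by
    rw [mem_singleton_iff.1 hz]; simp⟩

theorem OscBound.union (h : OscBound Ω z₀ T) (h' : OscBound Ω z₀ T') :
    OscBound Ω z₀ (T ∪ T') := by
  obtain ⟨h1, h2, h3, C, hC⟩ := h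
  obtain ⟨h1', h2', -, C', hC'⟩ := h'
  refine ⟨h1.union h1', union_subset h2 h2', Or.inl h3, max C C', fun F M hF hM z hz => ?_⟩
  have hM0 : 0 ≤ M := (norm_nonneg _).trans (hM z₀ (Or.inl h3))
  rcases hz with hz | hz
  · exact (hC F M hF (fun w hw => hM w (Or.inl hw)) z hz).trans
      (mul_le_mul_of_nonneg_right (le_max_left _ _) hM0)
  · exact (hC' F M hF (fun w hw => hM w (Or.inr hw)) z hz).trans
      (mul_le_mul_of_nonneg_right (le_max_right _ _) hM0)

theorem OscBound.union_closedBall (h : OscBound Ω z₀ T) {x y : ℂ} {r : ℝ} (hy : y ∈ T)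
    (hyr : y ∈ Metric.closedBall x r) (hr : Metric.closedBall x r ⊆ Ω) :
    OscBound Ω z₀ (T ∪ Metric.closedBall x r) := by
  obtain ⟨h1, h2, h3, C, hC⟩ := h
  have hr0 : 0 ≤ r := dist_nonneg.trans (Metric.mem_closedBall.1 hyr)
  refine ⟨h1.union (isCompact_closedBall x r), union_subset h2 hr, Or.inl h3, C + 2 * r,
    fun F M hF hM z hz => ?_⟩
  have hM0 : 0 ≤ M := (norm_nonneg _).trans (hM z₀ (Or.inl h3))
  have hT := hC F M hF fun w hw => hM w (Or.inl hw)
  have hrM : 0 ≤ 2 * r * M := by positivity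
  rcases hz with hz | hz
  · have := hT z hz
    rw [add_mul]
    linarith
  · have hb := Convex.norm_image_sub_le_of_norm_deriv_le (f := F) (C := M)
      (fun w hw => hF.differentiableAt (Ω.isOpen.mem_nhds (hr hw)))
      (fun w hw => hM w (Or.inr hw)) (convex_closedBall x r) hyr hz
    have hzy : ‖z - y‖ ≤ 2 * r := by
      rw [← dist_eq]
      have := dist_triangle_right z y x
      have h1 := Metric.mem_closedBall.1 hz
      have h2 := Metric.mem_closedBall.1 hyr
      linarith
    calc ‖F z - F z₀‖ ≤ ‖F z - F y‖ + ‖F y - F z₀‖ := norm_sub_le_norm_sub_add_norm_sub _ _ _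
      _ ≤ M * (2 * r) + C * M := add_le_add
          (hb.trans (mul_le_mul_of_nonneg_left hzy hM0)) (hT y hy)
      _ = (C + 2 * r) * M := by ring

/-- Points reachable from `z₀` by finite chains of closed discs in `Ω` form an open and relatively
closed set; each disc adds a mean value estimate. -/
theorem exists_oscBound_mem_nhds (hΩ : IsPreconnected (Ω : Set ℂ)) (hz₀ : z₀ ∈ Ω) {x : ℂ}
    (hx : x ∈ Ω) : ∃ T, OscBound Ω z₀ T ∧ T ∈ 𝓝 x := by
  set A : Set ℂ := {x | ∃ T, OscBound Ω z₀ T ∧ T ∈ 𝓝 x} with hA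
  have hball : ∀ x ∈ Ω, ∃ r > 0, Metric.closedBall x r ⊆ Ω := fun x hx =>
    Metric.nhds_basis_closedBall.mem_iff.1 (Ω.isOpen.mem_nhds hx)
  have hAo : IsOpen A := by
    rw [isOpen_iff_mem_nhds]
    rintro x ⟨T, hT, hTx⟩
    filter_upwards [eventually_mem_nhds_iff.2 hTx] with y hy using ⟨T, hT, hy⟩
  refine hΩ.subset_of_closure_inter_subset hAo ⟨z₀, hz₀, ?_⟩ ?_ hx
  · obtain ⟨r, hr, hrΩ⟩ := hball z₀ hz₀
    exact ⟨_, (oscBound_singleton hz₀).union_closedBall rfl (Metric.mem_closedBall_self hr.le) hrΩ,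
      mem_of_superset (Metric.closedBall_mem_nhds z₀ hr) subset_union_right⟩
  · rintro x ⟨hxA, hxΩ⟩
    obtain ⟨r, hr, hrΩ⟩ := hball x hxΩ
    obtain ⟨y, ⟨T, hT, hTy⟩, hyr⟩ := Metric.mem_closure_iff.1 hxA r hr
    refine ⟨_, hT.union_closedBall (mem_of_mem_nhds hTy) ?_ hrΩ,
      mem_of_superset (Metric.closedBall_mem_nhds x hr) subset_union_right⟩
    rw [Metric.mem_closedBall, dist_comm]
    exact hyr.le

theorem exists_oscBound_superset (hΩ : IsPreconnected (Ω : Set ℂ)) (hz₀ : z₀ ∈ Ω) {K : Set ℂ}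
    (hK : IsCompact K) (hKΩ : K ⊆ Ω) : ∃ T, OscBound Ω z₀ T ∧ K ⊆ T := by
  refine hK.induction_on (p := fun s => ∃ T, OscBound Ω z₀ T ∧ s ⊆ T)
    ⟨_, oscBound_singleton hz₀, empty_subset _⟩ ?_ ?_ ?_
  · rintro s t hst ⟨T, hT, htT⟩
    exact ⟨T, hT, hst.trans htT⟩
  · rintro s t ⟨T, hT, hsT⟩ ⟨T', hT', htT'⟩
    exact ⟨_, hT.union hT', union_subset_union hsT htT'⟩
  · intro x hx
    obtain ⟨T, hT, hTx⟩ := exists_oscBound_mem_nhds hΩ hz₀ (hKΩ hx)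
    exact ⟨T, mem_nhdsWithin_of_mem_nhds hTx, T, hT, subset_rfl⟩

/-- Maximum principle for `F - F z₀`: the frontier of `fill T` lies in `T`, so the same constant
works. -/
theorem OscBound.fill [SimplyConnectedSpace Ω] (h : OscBound Ω z₀ T) : OscBound Ω z₀ (fill T) := by
  obtain ⟨h1, h2, h3, C, hC⟩ := h
  have hsub := fill_subset h1 h2
  have hcl := (isCompact_fill h1).isClosed
  refine ⟨isCompact_fill h1, hsub, Or.inl h3, C, fun F M hF hM z hz => ?_⟩
  have hT := hC F M hF fun w hw => hM w (Or.inl hw)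
  refine norm_le_of_forall_mem_frontier_norm_le (f := fun z => F z - F z₀)
    (isCompact_fill h1).isBounded ?_ (fun w hw => hT w (frontier_fill_subset h1 hw))
    (subset_closure hz)
  refine DifferentiableOn.diffContOnCl ?_
  rw [hcl.closure_eq]
  exact (hF.mono hsub).sub_const _

end OscBound

theorem isPreconnected_coe (Ω : Opens ℂ) [SimplyConnectedSpace Ω] :
    IsPreconnected (Ω : Set ℂ) :=
  isPreconnected_iff_preconnectedSpace.2 (inferInstance : PreconnectedSpace Ω)

/-- Every compact subset of a simply connected domain lies in a compact subset with connected
complement, on which the oscillation of holomorphic functions is controlled by the derivative. -/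
theorem exists_compact_superset (Ω : Opens ℂ) [SimplyConnectedSpace Ω] {K : Set ℂ}
    (hK : IsCompact K) (hKΩ : K ⊆ Ω) :
    ∃ T : Set ℂ, IsCompact T ∧ K ⊆ T ∧ T ⊆ Ω ∧ T.Nonempty ∧ IsPreconnected Tᶜ ∧
      ∃ C : ℝ, 0 ≤ C ∧ ∀ (F : ℂ → ℂ) (M : ℝ), DifferentiableOn ℂ F Ω →
        (∀ z ∈ T, ‖deriv F z‖ ≤ M) → ∀ z ∈ T, ∀ w ∈ T, ‖F z - F w‖ ≤ C * M := by
  obtain ⟨z₀, hz₀⟩ : (Ω : Set ℂ).Nonempty := nonempty_subtype.1 (inferInstance : Nonempty Ω)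
  obtain ⟨T, hT, hKT⟩ := exists_oscBound_superset (isPreconnected_coe Ω) hz₀ hK hKΩ
  have hc := isPreconnected_compl_fill hT.1
  obtain ⟨h1, h2, h3, C, hC⟩ := hT.fill
  refine ⟨_, h1, hKT.trans (subset_fill T), h2, ⟨z₀, h3⟩, hc, 2 * max C 0, by positivity,
    fun F M hF hM z hz w hw => ?_⟩
  have hM0 : 0 ≤ M := (norm_nonneg _).trans (hM z₀ h3)
  have hle : C * M ≤ max C 0 * M := mul_le_mul_of_nonneg_right (le_max_left _ _) hM0
  have hz' := hC F M hF hM z hz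
  have hw' := hC F M hF hM w hw
  have := norm_sub_le_norm_sub_add_norm_sub (F z) (F z₀) (F w)
  rw [norm_sub_rev (F z₀)] at this
  linarith

/-- Run-away yields a single index with no control on its size. Adjoining `z₀` and `φ i z₀` for `i <
N` to the compact set rules out every index below `N`. -/
theorem exists_injOn_disjoint {Ω : Opens ℂ} [Nonempty Ω] {φ : ℕ → C(Ω, Ω)} (hr : IsRunAway φ)
    (hi : IsEventuallyInjective φ) {K : Set Ω} (hK : IsCompact K) :
    ∃ n, InjOn (φ n) K ∧ φ n '' K ∩ K = ∅ := by
  obtain ⟨N, hN⟩ := hi K hK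
  obtain ⟨z₀⟩ := ‹Nonempty Ω›
  set K' : Set Ω := K ∪ insert z₀ ((fun i => φ i z₀) '' (Finset.range N : Set ℕ)) with hK'
  have hK'c : IsCompact K' :=
    hK.union (((Finset.range N).finite_toSet.image _).insert z₀).isCompact
  obtain ⟨n, hn⟩ := hr K' hK'c
  have hnN : N ≤ n := by
    by_contra! hlt
    have : φ n z₀ ∈ φ n '' K' ∩ K' := ⟨⟨z₀, Or.inr (Or.inl rfl), rfl⟩,
      Or.inr (Or.inr ⟨n, by simpa using hlt, rfl⟩)⟩
    rw [hn] at this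
    exact this
  refine ⟨n, hN n hnN, subset_empty_iff.1 ?_⟩
  rw [← hn]
  exact inter_subset_inter (image_mono subset_union_left) subset_union_left

/-- The composition operators associated with a run-away and eventually injective sequence act
topologically transitively on the locally univalent functions. -/
theorem exists_transitive {Ω : Opens ℂ} [SimplyConnectedSpace Ω] {φ : ℕ → C(Ω, Ω)}
    (hφ : ∀ n, IsLocallyUnivalentSelfMap (φ n)) (hr : IsRunAway φ)
    (hi : IsEventuallyInjective φ) {G₀ g : C(Ω, ℂ)} (hG₀ : G₀ ∈ Hlu Ω) (hg : g ∈ Hlu Ω)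
    {K : Set Ω} (hK : IsCompact K) {ε : ℝ} (hε : 0 < ε) :
    ∃ n, ∃ G ∈ Hlu Ω, (∀ z ∈ K, dist (G z) (G₀ z) < ε) ∧
      ∀ z ∈ K, dist (G (φ n z)) (g z) < ε := by
  obtain ⟨T, hTc, hKT, hTΩ, hTne, hTp, C, hC0, hC⟩ := exists_compact_superset Ω
    (hK.image continuous_subtype_val) (by rintro _ ⟨z, -, rfl⟩; exact z.2)
  obtain ⟨δ, hδ, hδΩ⟩ := hTc.exists_cthickening_subset_open Ω.isOpen hTΩ
  set U := Metric.thickening δ T with hU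
  have hUo : IsOpen U := Metric.isOpen_thickening
  have hTU : T ⊆ U := Metric.self_subset_thickening hδ T
  have hUc : U ⊆ Metric.cthickening δ T := Metric.thickening_subset_cthickening δ T
  have hUΩ : U ⊆ Ω := hUc.trans hδΩ
  -- Run-away and injectivity are applied to a compact neighbourhood of `T`, because the holomorphic
  -- inverse needs injectivity on an open set.
  have hQ : IsCompact ((↑) ⁻¹' Metric.cthickening δ T : Set Ω) := by
    have e : Subtype.val '' ((↑) ⁻¹' Metric.cthickening δ T : Set Ω) = Metric.cthickening δ T :=
      image_preimage_eq_of_subset fun z hz => ⟨⟨z, hδΩ hz⟩, rfl⟩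
    exact Topology.IsInducing.subtypeVal.isCompact_iff.2
      ((congrArg IsCompact e).mpr hTc.cthickening)
  obtain ⟨n, hinj, hdisj⟩ := exists_injOn_disjoint hr hi hQ
  obtain ⟨F, hFφ', hFd, hF0⟩ := hφ n
  have hFφ : ∀ z : Ω, F z = (φ n z : ℂ) := hFφ'
  obtain ⟨F₀, hFG₀, hF₀d, hF₀0⟩ := hG₀
  obtain ⟨f, hfg, hfd, hf0⟩ := hg
  have hFinj : InjOn F U := by
    intro z hz w hw hzw
    have h1 := hFφ ⟨z, hUΩ hz⟩
    have h2 := hFφ ⟨w, hUΩ hw⟩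
    rw [h1, h2] at hzw
    exact congrArg Subtype.val (hinj (show (⟨z, hUΩ hz⟩ : Ω) ∈ _ from hUc hz)
      (show (⟨w, hUΩ hw⟩ : Ω) ∈ _ from hUc hw) (Subtype.ext hzw))
  have hTL : Disjoint T (F '' T) := by
    rw [disjoint_right]
    rintro _ ⟨z, hz, rfl⟩ hFz
    have h1 := hFφ ⟨z, hTΩ hz⟩
    rw [h1] at hFz
    have : φ n ⟨z, hTΩ hz⟩ ∈ φ n '' ((↑) ⁻¹' Metric.cthickening δ T : Set Ω) ∩
        ((↑) ⁻¹' Metric.cthickening δ T : Set Ω) :=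
      ⟨⟨⟨z, hTΩ hz⟩, hUc (hTU hz), rfl⟩, hUc (hTU hFz)⟩
    rw [hdisj] at this
    exact this
  have hFdU := hFd.mono hUΩ
  have hLp := isPreconnected_compl_image hTc hTp hUo hTU hFdU hFinj fun z hz => hF0 z (hUΩ hz)
  obtain ⟨ψ, hVo, hψd, hψ⟩ := exists_inverse hUo hFdU hFinj fun z hz => hF0 z (hUΩ hz)
  have hLc : IsCompact (F '' T) := hTc.image_of_continuousOn (hFd.continuousOn.mono hTΩ)
  obtain ⟨⟨k, l⟩, ⟨hk, hl⟩, hmin⟩ := (hTc.prod hLc).exists_isMinOn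
    (hTne.prod (hTne.image F)) (continuous_dist.continuousOn)
  obtain ⟨m, hm, rfl⟩ := hl
  obtain ⟨a, had, hae⟩ := exists_differentiableOn_log (hF₀d.deriv Ω.isOpen) hF₀0
  obtain ⟨b, hbd, hbe⟩ := exists_differentiableOn_log (hfd.deriv Ω.isOpen) hf0
  obtain ⟨c, hcd, hce⟩ := exists_differentiableOn_log (hFd.deriv Ω.isOpen) hF0
  have hψm : MapsTo ψ (F '' U) Ω := by
    rintro _ ⟨z, hz, rfl⟩
    rw [hψ z hz]
    exact hUΩ hz
  obtain ⟨N, hN⟩ := hTc.exists_bound_of_continuousOn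
    ((hFd.deriv Ω.isOpen).continuousOn.mono hTΩ)
  have hN0 : 0 ≤ N := (norm_nonneg _).trans (hN m hm)
  -- The final errors are `C * η` for `G - F₀`, and `C * (η * N) + η` for `G ∘ F - f`, the last `η`
  -- being the error at `F m`.
  set η := ε / (C * N + C + 2) with hη
  have hη0 : 0 < η := by positivity
  have hηε : η * (C * N + C + 2) = ε := by
    rw [hη]; field_simp
  have hCN : 0 ≤ C * N := mul_nonneg hC0 hN0
  -- `b ∘ ψ - c ∘ ψ` is a logarithm of the derivative of `f ∘ ψ`, with `ψ` the local inverse of `F`.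
  obtain ⟨G, p, hG, hGT, hGL, hGk, hGl⟩ := exists_entire_bridge hTc hLc hTp hLp hTL hk
    (mem_image_of_mem F hm) (fun x hx y hy => hmin (mk_mem_prod hx hy)) Ω.isOpen hTΩ hVo
    (image_mono hTU) had (b := fun w => b (ψ w) - c (ψ w))
    ((hbd.comp hψd hψm).sub (hcd.comp hψd hψm)) (F₀ k) (f m) hη0
  have hGd : Differentiable ℂ G := fun z => (hG z).differentiableAt
  refine ⟨n, ⟨fun z => G z, hGd.continuous.comp continuous_subtype_val⟩,
    ⟨G, fun z => rfl, hGd.differentiableOn, fun z _ => ?_⟩, fun z hz => ?_, fun z hz => ?_⟩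
  · rw [(hG z).deriv]
    exact exp_ne_zero _
  · have hzT : (z : ℂ) ∈ T := hKT (mem_image_of_mem _ hz)
    have h1 := hC (fun w => G w - F₀ w) η (hGd.differentiableOn.sub hF₀d) (fun w hw => ?_)
      z hzT k hk
    · rw [hGk, sub_self, sub_zero] at h1
      rw [← hFG₀ z, dist_eq]
      exact h1.trans_lt (by nlinarith)
    · have hd := hF₀d.differentiableAt (Ω.isOpen.mem_nhds (hTΩ hw))
      rw [deriv_fun_sub (hGd w) hd, (hG w).deriv, ← hae w (hTΩ hw)]
      exact (hGT w hw).le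
  · have hzT : (z : ℂ) ∈ T := hKT (mem_image_of_mem _ hz)
    -- The comparison is pulled back to `T`, so no oscillation bound on `F '' T` is needed.
    have h1 := hC (fun w => G (F w) - f w) (η * N)
      ((hGd.comp_differentiableOn hFd).sub hfd) (fun w hw => ?_) z hzT m hm
    · show dist (G (φ n z)) (g z) < ε
      rw [← hfg z, ← hFφ z, dist_eq]
      have h2 := norm_sub_le_norm_sub_add_norm_sub (G (F z) - f z) (G (F m) - f m) 0
      rw [sub_zero, sub_zero] at h2
      nlinarith
    · have hd := hfd.differentiableAt (Ω.isOpen.mem_nhds (hTΩ hw))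
      have hdF := hFd.differentiableAt (Ω.isOpen.mem_nhds (hTΩ hw))
      have hcomp : HasDerivAt (fun w => G (F w)) (exp (p (F w)) * deriv F w) w :=
        (hG (F w)).comp w hdF.hasDerivAt
      have h2 := hGL (F w) (mem_image_of_mem F hw)
      rw [hψ w (hTU hw), exp_sub, hbe w (hTΩ hw), hce w (hTΩ hw)] at h2
      rw [(hcomp.fun_sub hd.hasDerivAt).deriv]
      have hF0w := hF0 w (hTΩ hw)
      have e : exp (p (F w)) * deriv F w - deriv f w =
          (exp (p (F w)) - deriv f w / deriv F w) * deriv F w := by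
        field_simp
      rw [e, norm_mul]
      exact mul_le_mul h2.le (hN w hw) (norm_nonneg _) hη0.le

end LocUniv

/-! ### The Baire category argument -/

namespace LocUniv

open Set Filter Topology Complex

/-- The extension by zero of a function on `Ω` to the plane. -/
noncomputable def extendZero {Ω : Opens ℂ} (f : Ω → ℂ) : ℂ → ℂ := Function.extend Subtype.val f 0

theorem extendZero_coe {Ω : Opens ℂ} (f : Ω → ℂ) (z : Ω) : extendZero f z = f z :=
  Subtype.val_injective.extend_apply f 0 z

theorem isLocallyUnivalent_iff {Ω : Opens ℂ} {f : Ω → ℂ} :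
    IsLocallyUnivalent f ↔
      DifferentiableOn ℂ (extendZero f) Ω ∧ ∀ z ∈ Ω, deriv (extendZero f) z ≠ 0 := by
  refine ⟨?_, fun h => ⟨extendZero f, extendZero_coe f, h.1, h.2⟩⟩
  rintro ⟨F, hF, hd, h0⟩
  have he : EqOn (extendZero f) F Ω := fun z hz => by
    rw [hF ⟨z, hz⟩, ← extendZero_coe f ⟨z, hz⟩]
  refine ⟨hd.congr he, fun z hz => ?_⟩
  rw [(he.eventuallyEq_of_mem (Ω.isOpen.mem_nhds hz)).deriv_eq]
  exact h0 z hz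

theorem comp_mem_Hlu {Ω : Opens ℂ} {φ : C(Ω, Ω)} (hφ : IsLocallyUnivalentSelfMap φ)
    {G : C(Ω, ℂ)} (hG : G ∈ Hlu Ω) : G.comp φ ∈ Hlu Ω := by
  obtain ⟨F, hF, hFd, hF0⟩ := hG
  obtain ⟨f, hf', hfd, hf0⟩ := hφ
  have hf : ∀ z : Ω, f z = (φ z : ℂ) := hf'
  have hm : MapsTo f Ω Ω := fun z hz => by
    rw [hf ⟨z, hz⟩]
    exact (φ ⟨z, hz⟩).2
  refine ⟨fun z => F (f z), fun z => ?_, hFd.comp hfd hm, fun z hz => ?_⟩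
  · exact (congrArg F (hf z)).trans (hF (φ z))
  · have h1 := (hFd.differentiableAt (Ω.isOpen.mem_nhds (hm hz))).hasDerivAt
    have h2 := (hfd.differentiableAt (Ω.isOpen.mem_nhds hz)).hasDerivAt
    have h3 : HasDerivAt (fun z => F (f z)) _ z := h1.comp z h2
    rw [h3.deriv]
    exact mul_ne_zero (hF0 _ (hm hz)) (hf0 z hz)

theorem id_mem_Hlu (Ω : Opens ℂ) : (⟨Subtype.val, continuous_subtype_val⟩ : C(Ω, ℂ)) ∈ Hlu Ω :=
  ⟨fun z => z, fun _ => rfl, differentiableOn_id, fun z _ => by simp⟩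

/-- The functions in `C(Ω, ℂ)` which are holomorphic. -/
def holo (Ω : Opens ℂ) : Set C(Ω, ℂ) :=
  {f | DifferentiableOn ℂ (extendZero (f : Ω → ℂ)) Ω}

instance instLocallyCompactSpaceOpens (Ω : Opens ℂ) : LocallyCompactSpace Ω :=
  Ω.isOpen.locallyCompactSpace

theorem tendstoLocallyUniformlyOn_extendZero {Ω : Opens ℂ} (f : C(Ω, ℂ)) (s : Set C(Ω, ℂ)) :
    TendstoLocallyUniformlyOn (fun g : C(Ω, ℂ) => extendZero (g : Ω → ℂ))
      (extendZero (f : Ω → ℂ)) (𝓝[s] f) Ω := by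
  rw [tendstoLocallyUniformlyOn_iff_tendstoLocallyUniformly_comp_coe]
  have h : Tendsto (fun g : C(Ω, ℂ) => g) (𝓝[s] f) (𝓝 f) := tendsto_id.mono_left nhdsWithin_le_nhds
  rw [ContinuousMap.tendsto_iff_tendstoLocallyUniformly] at h
  have h' : TendstoLocallyUniformly (fun (g : C(Ω, ℂ)) (x : Ω) => extendZero (g : Ω → ℂ) x)
      (fun x : Ω => extendZero (f : Ω → ℂ) x) (𝓝[s] f) := by
    simpa only [extendZero_coe] using h
  exact h'

theorem isClosed_holo (Ω : Opens ℂ) : IsClosed (holo Ω) := by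
  refine isClosed_of_closure_subset fun f hf => ?_
  have : (𝓝[holo Ω] f).NeBot := mem_closure_iff_nhdsWithin_neBot.1 hf
  exact (tendstoLocallyUniformlyOn_extendZero f (holo Ω)).differentiableOn
    (eventually_mem_nhdsWithin) Ω.isOpen

/-- Along holomorphic functions derivatives converge uniformly on `K`, and `‖f'‖` has a positive
minimum there when `K` is nonempty. -/
theorem eventually_deriv_ne_zero {Ω : Opens ℂ} {f : C(Ω, ℂ)} (hf : f ∈ holo Ω) {K : Set ℂ}
    (hK : IsCompact K) (hKΩ : K ⊆ Ω) (h0 : ∀ z ∈ K, deriv (extendZero (f : Ω → ℂ)) z ≠ 0) :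
    ∀ᶠ g : C(Ω, ℂ) in 𝓝[holo Ω] f, ∀ z ∈ K, deriv (extendZero (g : Ω → ℂ)) z ≠ 0 := by
  rcases K.eq_empty_or_nonempty with rfl | hne
  · simp
  have h1 := (tendstoLocallyUniformlyOn_extendZero f (holo Ω)).deriv
    (eventually_mem_nhdsWithin) Ω.isOpen
  have h2 := (tendstoLocallyUniformlyOn_iff_forall_isCompact Ω.isOpen).1 h1 K hKΩ hK
  have hfd : DifferentiableOn ℂ (extendZero (f : Ω → ℂ)) Ω := hf
  obtain ⟨z₀, hz₀, hmin⟩ := hK.exists_isMinOn hne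
    ((hfd.deriv Ω.isOpen).continuousOn.mono hKΩ).norm
  filter_upwards [Metric.tendstoUniformlyOn_iff.1 h2 _ (norm_pos_iff.2 (h0 z₀ hz₀))]
    with g hg z hz hgz
  have h3 := hg z hz
  have h4 : ‖deriv (extendZero (f : Ω → ℂ)) z₀‖ ≤ ‖deriv (extendZero (f : Ω → ℂ)) z‖ := hmin hz
  simp only [Function.comp_apply, hgz, dist_zero_right] at h3
  linarith

theorem isGδ_Hlu (Ω : Opens ℂ) : IsGδ (Hlu Ω) := by
  set E : CompactExhaustion Ω := default
  set W : ℕ → Set C(Ω, ℂ) := fun n =>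
    {f | ∀ z ∈ Subtype.val '' E n, deriv (extendZero (f : Ω → ℂ)) z ≠ 0} with hW
  -- Zero-freeness of the derivative on a compact set is open only relative to `holo Ω`; adding the
  -- complement of `holo Ω` makes it an open condition in `C(Ω, ℂ)`.
  have key : Hlu Ω = holo Ω ∩ ⋂ n, interior (W n ∪ (holo Ω)ᶜ) := by
    ext f
    constructor
    · intro hf
      obtain ⟨hd, h0⟩ := isLocallyUnivalent_iff.1 hf
      refine ⟨hd, mem_iInter.2 fun n => mem_interior_iff_mem_nhds.2 ?_⟩
      have := eventually_deriv_ne_zero (f := f) hd ((E.isCompact n).image continuous_subtype_val)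
        (by rintro _ ⟨z, -, rfl⟩; exact z.2) (by rintro _ ⟨z, -, rfl⟩; exact h0 z z.2)
      filter_upwards [eventually_nhdsWithin_iff.1 this] with g hg
      by_cases hgh : g ∈ holo Ω
      · exact Or.inl (hg hgh)
      · exact Or.inr hgh
    · rintro ⟨hd, h0⟩
      refine isLocallyUnivalent_iff.2 ⟨hd, fun z hz => ?_⟩
      obtain ⟨n, hn⟩ := E.exists_mem ⟨z, hz⟩
      rcases interior_subset (mem_iInter.1 h0 n) with h | h
      · exact h z ⟨_, hn, rfl⟩
      · exact (h hd).elim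
  rw [key]
  exact (isClosed_holo Ω).isGδ.inter (IsGδ.iInter_of_isOpen fun n => isOpen_interior)

/-- A `Gδ` subset of a completely metrizable space is a Baire space. -/
theorem baireSpace_of_isGδ {X : Type*} [TopologicalSpace X] [IsCompletelyMetrizableSpace X]
    {s : Set X} (hs : IsGδ s) : BaireSpace s := by
  -- `s` is a dense `Gδ` in its closure, which is completely metrizable.
  have : IsCompletelyMetrizableSpace (closure s) := isClosed_closure.isCompletelyMetrizableSpace
  have hr : range (inclusion (subset_closure : s ⊆ closure s)) = Subtype.val ⁻¹' s := by
    rw [range_inclusion]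
    rfl
  have hG : IsGδ (range (inclusion (subset_closure : s ⊆ closure s))) := by
    rw [hr]
    exact hs.preimage continuous_subtype_val
  have hd : DenseRange (inclusion (subset_closure : s ⊆ closure s)) :=
    (denseRange_inclusion_iff subset_closure).2 subset_rfl
  have := hG.baireSpace_of_dense hd
  exact (Topology.IsEmbedding.inclusion
    (subset_closure : s ⊆ closure s)).toHomeomorph.symm.baireSpace

theorem exists_compact_of_mem_nhds {Ω : Opens ℂ} {f : C(Ω, ℂ)} {V : Set C(Ω, ℂ)} (hV : V ∈ 𝓝 f) :
    ∃ K : Set Ω, IsCompact K ∧ ∃ ε > 0, ∀ h : C(Ω, ℂ), (∀ z ∈ K, dist (h z) (f z) < ε) → h ∈ V := by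
  have hb := nhds_basis_uniformity
    (Metric.uniformity_basis_dist.compactConvergenceUniformity (α := Ω) (β := ℂ)) (x := f)
  obtain ⟨⟨K, ε⟩, ⟨hK, hε⟩, h⟩ := hb.mem_iff.1 hV
  exact ⟨K, hK, ε, hε, fun g hg => h hg⟩

/-- Only basic open sets that meet `Hlu Ω` matter, so universality becomes a countable intersection.
-/
theorem isUniversalIn_iff {Ω : Opens ℂ} {Φ : Set C(Ω, Ω)}
    (hΦ : ∀ φ ∈ Φ, IsLocallyUnivalentSelfMap φ) {G : C(Ω, ℂ)} (hG : G ∈ Hlu Ω) :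
    IsUniversalIn Φ (Hlu Ω) G ↔
      ∀ U ∈ {U ∈ countableBasis C(Ω, ℂ) | (U ∩ Hlu Ω).Nonempty}, ∃ φ ∈ Φ, G.comp φ ∈ U := by
  constructor
  · rintro ⟨-, -, hcl⟩ U ⟨hU, g, hgU, hg⟩
    obtain ⟨_, hU', φ, hφ, rfl⟩ := mem_closure_iff.1 (hcl hg) U
      (isOpen_of_mem_countableBasis hU) hgU
    exact ⟨φ, hφ, hU'⟩
  · intro h
    refine ⟨hG, ?_, fun g hg => ?_⟩
    · rintro _ ⟨φ, hφ, rfl⟩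
      exact comp_mem_Hlu (hΦ φ hφ) hG
    · rw [(isBasis_countableBasis C(Ω, ℂ)).mem_closure_iff]
      intro U hU hgU
      obtain ⟨φ, hφ, hU'⟩ := h U ⟨hU, g, hgU, hg⟩
      exact ⟨_, hU', φ, hφ, rfl⟩

theorem isOpen_setOf_comp_mem {Ω : Opens ℂ} (Φ : Set C(Ω, Ω)) {U : Set C(Ω, ℂ)} (hU : IsOpen U) :
    IsOpen {G : Hlu Ω | ∃ φ ∈ Φ, (G : C(Ω, ℂ)).comp φ ∈ U} := by
  have : {G : Hlu Ω | ∃ φ ∈ Φ, (G : C(Ω, ℂ)).comp φ ∈ U} =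
      ⋃ φ ∈ Φ, (fun G : Hlu Ω => (G : C(Ω, ℂ)).comp φ) ⁻¹' U := by
    ext G
    simp
  rw [this]
  exact isOpen_biUnion fun φ _ =>
    hU.preimage ((ContinuousMap.continuous_precomp φ).comp continuous_subtype_val)

theorem dense_setOf_comp_mem {Ω : Opens ℂ} [SimplyConnectedSpace Ω] {Φ : Set C(Ω, Ω)}
    (hΦ : ∀ φ ∈ Φ, IsLocallyUnivalentSelfMap φ) {φ : ℕ → C(Ω, Ω)} (hφ : ∀ n, φ n ∈ Φ)
    (hr : IsRunAway φ) (hi : IsEventuallyInjective φ) {U : Set C(Ω, ℂ)} (hU : IsOpen U)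
    (hne : (U ∩ Hlu Ω).Nonempty) : Dense {G : Hlu Ω | ∃ φ ∈ Φ, (G : C(Ω, ℂ)).comp φ ∈ U} := by
  obtain ⟨g, hgU, hg⟩ := hne
  rw [dense_iff_inter_open]
  rintro _ ⟨V, hV, rfl⟩ ⟨⟨G₀, hG₀⟩, hG₀V⟩
  obtain ⟨K, hK, ε, hε, hKV⟩ := exists_compact_of_mem_nhds (hV.mem_nhds hG₀V)
  obtain ⟨L, hL, δ, hδ, hLU⟩ := exists_compact_of_mem_nhds (hU.mem_nhds hgU)
  obtain ⟨n, G, hG, h1, h2⟩ := exists_transitive (fun n => hΦ _ (hφ n)) hr hi hG₀ hg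
    (hK.union hL) (lt_min hε hδ)
  exact ⟨⟨G, hG⟩, hKV G fun z hz => (h1 z (Or.inl hz)).trans_le (min_le_left _ _), φ n, hφ n,
    hLU _ fun z hz => (h2 z (Or.inr hz)).trans_le (min_le_right _ _)⟩

end LocUniv

theorem mainTheorem5 (Ω : TopologicalSpace.Opens ℂ) [SimplyConnectedSpace Ω]
    (Φ : Set C(Ω, Ω)) (hΦ : ∀ φ ∈ Φ, LocUniv.IsLocallyUnivalentSelfMap φ)
    (hseq : ∃ φ : ℕ → C(Ω, Ω), (∀ n, φ n ∈ Φ) ∧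
      LocUniv.IsRunAway φ ∧ LocUniv.IsEventuallyInjective φ) :
    (∃ G : C(Ω, ℂ), LocUniv.IsUniversalIn Φ (LocUniv.Hlu Ω) G) ∧
      IsGδ {G : LocUniv.Hlu Ω | LocUniv.IsUniversalIn Φ (LocUniv.Hlu Ω) (G : C(Ω, ℂ))} ∧
      Dense {G : LocUniv.Hlu Ω | LocUniv.IsUniversalIn Φ (LocUniv.Hlu Ω) (G : C(Ω, ℂ))} := by
  obtain ⟨φ, hφ, hr, hi⟩ := hseq
  have hB : BaireSpace (LocUniv.Hlu Ω) := LocUniv.baireSpace_of_isGδ (LocUniv.isGδ_Hlu Ω)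
  set B : Set (Set C(Ω, ℂ)) :=
    {U ∈ countableBasis C(Ω, ℂ) | (U ∩ LocUniv.Hlu Ω).Nonempty}
  have hBc : B.Countable := (countable_countableBasis C(Ω, ℂ)).mono fun U hU => hU.1
  have hset : {G : LocUniv.Hlu Ω | LocUniv.IsUniversalIn Φ (LocUniv.Hlu Ω) (G : C(Ω, ℂ))} =
      ⋂ U ∈ B, {G : LocUniv.Hlu Ω | ∃ φ ∈ Φ, (G : C(Ω, ℂ)).comp φ ∈ U} := by
    ext G
    simp only [Set.mem_iInter]
    exact LocUniv.isUniversalIn_iff hΦ G.2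
  have hopen : ∀ U ∈ B, IsOpen {G : LocUniv.Hlu Ω | ∃ φ ∈ Φ, (G : C(Ω, ℂ)).comp φ ∈ U} :=
    fun U hU => LocUniv.isOpen_setOf_comp_mem Φ (isOpen_of_mem_countableBasis hU.1)
  have hdense : Dense
      {G : LocUniv.Hlu Ω | LocUniv.IsUniversalIn Φ (LocUniv.Hlu Ω) (G : C(Ω, ℂ))} := by
    rw [hset]
    exact dense_biInter_of_isOpen hopen hBc fun U hU =>
      LocUniv.dense_setOf_comp_mem hΦ hφ hr hi (isOpen_of_mem_countableBasis hU.1) hU.2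
  refine ⟨?_, ?_, hdense⟩
  · have : Nonempty (LocUniv.Hlu Ω) := ⟨⟨_, LocUniv.id_mem_Hlu Ω⟩⟩
    obtain ⟨G, hG⟩ := hdense.nonempty
    exact ⟨G, hG⟩
  · rw [hset]
    exact IsGδ.biInter_of_isOpen hBc hopen
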